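/- Let $n\ge 0$ be an integer and $\alpha,\eta\in\mathbb C$. Let $M=\mathbb C^{4n+1}$ with coordinates $A_0,\dots,A_{2n},B_1,\dots,B_n,C_1,\dots,C_n$, and put $$A(\lambda)=\alpha\lambda^{2n+1}+A_{2n}\lambda^{2n}+\dots+A_0,\qquad B(\lambda)=\lambda^{2n+1}+B_n\lambda^{2n-1}+\dots+B_1\lambda,\qquad C(\lambda)=C_n\lambda^{2n-1}+\dots+C_1\lambda,$$ $$T(\lambda)=\begin{pmatrix}A(\lambda)&B(\lambda)\\ C(\lambda)&A(-\lambda)\end{pmatrix}.$$ For $k=0,1$ let $\{\cdot,\cdot\}_k$ be the bracket on holomorphic functions on open subsets of $M$, $\{f,g\}_k=\sum_{a,b}\{z_a,z_b\}_k\,\partial_af\,\partial_bg$ (the sums run over the coordinates), in which the brackets of the coordinates are given by the following generating functions and antisymmetry, with $\rho_0=0$ and $\rho_1(\lambda)=\alpha\lambda+A_{2n}$: $$\{B(\lambda),B(\mu)\}_k=0,$$ $$\{A(\lambda),A(\mu)\}_k=\tfrac{\eta}{\lambda+\mu}\bigl(\mu^{2k}B(\lambda)C(\mu)-\lambda^{2k}B(\mu)C(\lambda)\bigr),$$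 $$\{C(\lambda),C(\mu)\}_k=2\eta\bigl(\rho_k(-\mu)A(\mu)-\rho_k(\mu)A(-\mu)\bigr)C(\lambda)-2\eta\bigl(\rho_k(-\lambda)A(\lambda)-\rho_k(\lambda)A(-\lambda)\bigr)C(\mu),$$ $$\{A(\lambda),B(\mu)\}_k=\tfrac{\eta}{\lambda-\mu}\bigl(\lambda^{2k}A(\lambda)B(\mu)-\mu^{2k}A(\mu)B(\lambda)\bigr)+\tfrac{\eta}{\lambda+\mu}\bigl(\lambda^{2k}A(\lambda)B(\mu)+\mu^{2k}A(-\mu)B(\lambda)\bigr)-2\eta\rho_k(\lambda)B(\lambda)B(\mu),$$ $$\{A(\lambda),C(\mu)\}_k=-\tfrac{\eta}{\lambda-\mu}\bigl(\mu^{2k}A(\lambda)C(\mu)-\lambda^{2k}A(\mu)C(\lambda)\bigr)-2\eta k\lambda A(\lambda)C(\mu)-\tfrac{\eta}{\lambda+\mu}\bigl(\mu^{2k}A(\lambda)C(\mu)+\lambda^{2k}A(-\mu)C(\lambda)\bigr)+2\eta\rho_k(\lambda)B(\lambda)C(\mu),$$ $$\{B(\lambda),C(\mu)\}_k=\tfrac{\eta\lambda^{2k}}{\lambda-\mu}\bigl(A(-\lambda)A(\mu)-A(\lambda)A(-\mu)\bigr)+\tfrac{\eta\lambda^{2k}}{\lambda+\mu}\bigl(A(\lambda)A(\mu)-A(-\lambda)A(-\mu)\bigr)+2\eta\bigl(\rho_k(\mu)A(-\mu)-\rho_k(-\mu)A(\mu)\bigr)B(\lambda).$$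 Let $U\subseteq M$ be open and let $$K(\lambda)=\begin{pmatrix}\mathcal A(\lambda)&0\\ \mathcal C(\lambda)&\mathcal D(\lambda)\end{pmatrix},$$ where $\mathcal A,\mathcal D\in\mathbb C[\lambda]$ and $\mathcal C(\lambda)$ is a polynomial in $\lambda$ whose coefficients are holomorphic functions on $U$. Let $\tau(\lambda)=\operatorname{tr}K(\lambda)T(\lambda)=\sum_l\tau_l\lambda^l$. Suppose that $\tau(\lambda)$ has only $n$ independent dynamical coefficients $H_1,\dots,H_n$; that is, the $H_i$ are $n$ of the coefficients $\tau_l$, and at every point of some dense subset of $U$ the differentials $dH_1,\dots,dH_n$ are linearly independent modulo the span of the differentials of the coefficients of $\det T(\lambda)$ (the Casimir functions), while every $d\tau_l$ lies in the span of $dH_1,\dots,dH_n$ and the differentials of the coefficients of $\det T(\lambda)$. Then on $U$ $$\{H_i,H_j\}_0=\{H_i,H_j\}_1=0,\qquad i,j=1,\dots,n.$$ -/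

import Mathlib

open Polynomial

namespace ReflectionAlgebra

noncomputable section

/-! ### The phase space and the matrix `T(λ)` -/

/-- Labels of the `4 n + 1` generators `A_0, …, A_{2n}`, `B_1, …, B_n`, `C_1, …, C_n`
(the label `i : Fin n` of a `B` or a `C` stands for `B_{i+1}` or `C_{i+1}`). -/
abbrev Gen (n : ℕ) : Type := Fin (2 * n + 1) ⊕ (Fin n ⊕ Fin n)

/-- The label of `A_i`. -/
abbrev genA {n : ℕ} (i : Fin (2 * n + 1)) : Gen n := Sum.inl i

/-- The label of `B_{i+1}`. -/
abbrev genB {n : ℕ} (i : Fin n) : Gen n := Sum.inr (Sum.inl i)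

/-- The label of `C_{i+1}`. -/
abbrev genC {n : ℕ} (i : Fin n) : Gen n := Sum.inr (Sum.inr i)

/-- The `(4 n + 1)`-dimensional space with coordinates `A_i`, `B_i`, `C_i`. -/
abbrev Phase (n : ℕ) : Type := Gen n → ℂ

variable {n : ℕ}

/-- `A(λ) = α λ^{2n+1} + A_{2n} λ^{2n} + ⋯ + A_0`. -/
def polyA (α : ℂ) (z : Phase n) : ℂ[X] :=
  C α * X ^ (2 * n + 1) + ∑ i : Fin (2 * n + 1), C (z (genA i)) * X ^ (i : ℕ)

/-- `B(λ) = λ^{2n+1} + B_n λ^{2n-1} + ⋯ + B_1 λ`. -/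
def polyB (z : Phase n) : ℂ[X] :=
  X ^ (2 * n + 1) + ∑ i : Fin n, C (z (genB i)) * X ^ (2 * (i : ℕ) + 1)

/-- `C(λ) = C_n λ^{2n-1} + ⋯ + C_1 λ`. -/
def polyC (z : Phase n) : ℂ[X] :=
  ∑ i : Fin n, C (z (genC i)) * X ^ (2 * (i : ℕ) + 1)

/-- `T(λ)`, with rows `A(λ), B(λ)` and `C(λ), A(-λ)`. -/
def matT (α : ℂ) (z : Phase n) : Matrix (Fin 2) (Fin 2) ℂ[X] :=
  !![polyA α z, polyB z; polyC z, (polyA α z).comp (-X)]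

/-- The coefficient of `λ^l` in `det T(λ)`, as a function on the phase space. -/
def detCoeff (α : ℂ) (l : ℕ) (z : Phase n) : ℂ :=
  (matT α z).det.coeff l

/-! ### The two brackets

Polynomials in `λ` and `μ` are elements of `ℂ[X][X]`: the outer variable is `μ`, the inner one
is `λ`. -/

/-- The variable `λ` of `ℂ[λ][μ]`. -/
def lam : ℂ[X][X] := C X

/-- The variable `μ` of `ℂ[λ][μ]`. -/
def mu : ℂ[X][X] := X

/-- The value `f(x)` of a polynomial `f` at `x = ±λ, ±μ`. -/
def ev (f : ℂ[X]) (x : ℂ[X][X]) : ℂ[X][X] := aeval x f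

/-- The quotient `N / (λ - μ)` (all the divisions below are exact). -/
def divSub (N : ℂ[X][X]) : ℂ[X][X] := -(N /ₘ (X - C X))

/-- The quotient `N / (λ + μ)` (all the divisions below are exact). -/
def divAdd (N : ℂ[X][X]) : ℂ[X][X] := N /ₘ (X - C (-X))

/-- The coefficient of `λ^i μ^j`. -/
def coeff₂ (N : ℂ[X][X]) (i j : ℕ) : ℂ := (N.coeff j).coeff i

/-- `ρ_k(λ)`, the polynomial part of `λ^{2k-1} A(λ) / B(λ)`:
`ρ_0 = 0` and `ρ_1 = α λ + A_{2n}`. -/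
def rho (α : ℂ) (z : Phase n) : Fin 2 → ℂ[X] :=
  ![0, C α * X + C (z (genA (Fin.last (2 * n))))]

/-- `{A(λ), A(μ)}_k`. -/
def brAA (η : ℂ) (k : Fin 2) (z : Phase n) : ℂ[X][X] :=
  η • divAdd
    (mu ^ (2 * (k : ℕ)) * ev (polyB z) lam * ev (polyC z) mu
      - lam ^ (2 * (k : ℕ)) * ev (polyB z) mu * ev (polyC z) lam)

/-- `{C(λ), C(μ)}_k`. -/
def brCC (α η : ℂ) (k : Fin 2) (z : Phase n) : ℂ[X][X] :=
  (2 * η) • ((ev (rho α z k) (-mu) * ev (polyA α z) mu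
      - ev (rho α z k) mu * ev (polyA α z) (-mu)) * ev (polyC z) lam)
    - (2 * η) • ((ev (rho α z k) (-lam) * ev (polyA α z) lam
      - ev (rho α z k) lam * ev (polyA α z) (-lam)) * ev (polyC z) mu)

/-- `{A(λ), B(μ)}_k`. -/
def brAB (α η : ℂ) (k : Fin 2) (z : Phase n) : ℂ[X][X] :=
  η • divSub
    (lam ^ (2 * (k : ℕ)) * ev (polyA α z) lam * ev (polyB z) mu
      - mu ^ (2 * (k : ℕ)) * ev (polyA α z) mu * ev (polyB z) lam)
    + η • divAdd
      (lam ^ (2 * (k : ℕ)) * ev (polyA α z) lam * ev (polyB z) mu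
        + mu ^ (2 * (k : ℕ)) * ev (polyA α z) (-mu) * ev (polyB z) lam)
    - (2 * η) • (ev (rho α z k) lam * ev (polyB z) lam * ev (polyB z) mu)

/-- `{A(λ), C(μ)}_k`. -/
def brAC (α η : ℂ) (k : Fin 2) (z : Phase n) : ℂ[X][X] :=
  -(η • divSub
      (mu ^ (2 * (k : ℕ)) * ev (polyA α z) lam * ev (polyC z) mu
        - lam ^ (2 * (k : ℕ)) * ev (polyA α z) mu * ev (polyC z) lam))
    - (2 * η * ((k : ℕ) : ℂ)) • (lam * ev (polyA α z) lam * ev (polyC z) mu)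
    - η • divAdd
      (mu ^ (2 * (k : ℕ)) * ev (polyA α z) lam * ev (polyC z) mu
        + lam ^ (2 * (k : ℕ)) * ev (polyA α z) (-mu) * ev (polyC z) lam)
    + (2 * η) • (ev (rho α z k) lam * ev (polyB z) lam * ev (polyC z) mu)

/-- `{B(λ), C(μ)}_k`. -/
def brBC (α η : ℂ) (k : Fin 2) (z : Phase n) : ℂ[X][X] :=
  η • (lam ^ (2 * (k : ℕ)) * divSub
      (ev (polyA α z) (-lam) * ev (polyA α z) mu - ev (polyA α z) lam * ev (polyA α z) (-mu)))
    + η • (lam ^ (2 * (k : ℕ)) * divAdd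
      (ev (polyA α z) lam * ev (polyA α z) mu
        - ev (polyA α z) (-lam) * ev (polyA α z) (-mu)))
    + (2 * η) • ((ev (rho α z k) mu * ev (polyA α z) (-mu)
      - ev (rho α z k) (-mu) * ev (polyA α z) mu) * ev (polyB z) lam)

/-- The brackets `{·,·}_k` of the generators, read off as coefficients of the generating
functions above; `{B_i, B_j}_k = 0`, and the missing cases are given by antisymmetry. -/
def tensor (α η : ℂ) (k : Fin 2) (z : Phase n) : Gen n → Gen n → ℂ
  | .inl i, .inl j => coeff₂ (brAA η k z) i j
  | .inl i, .inr (.inl j) => coeff₂ (brAB α η k z) i (2 * j + 1)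
  | .inl i, .inr (.inr j) => coeff₂ (brAC α η k z) i (2 * j + 1)
  | .inr (.inl i), .inl j => -coeff₂ (brAB α η k z) j (2 * i + 1)
  | .inr (.inl _), .inr (.inl _) => 0
  | .inr (.inl i), .inr (.inr j) => coeff₂ (brBC α η k z) (2 * i + 1) (2 * j + 1)
  | .inr (.inr i), .inl j => -coeff₂ (brAC α η k z) j (2 * i + 1)
  | .inr (.inr i), .inr (.inl j) => -coeff₂ (brBC α η k z) (2 * j + 1) (2 * i + 1)
  | .inr (.inr i), .inr (.inr j) => coeff₂ (brCC α η k z) (2 * i + 1) (2 * j + 1)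

/-- The partial derivative of `f` in the coordinate labelled `a`. -/
def partialDeriv (a : Gen n) (f : Phase n → ℂ) (z : Phase n) : ℂ :=
  fderiv ℂ f z (Pi.single a 1)

/-- The bracket `{f, g}_k` of two functions on the phase space, for `k = 0, 1`. -/
def bracket (α η : ℂ) (k : Fin 2) (f g : Phase n → ℂ) (z : Phase n) : ℂ :=
  ∑ a, ∑ b, tensor α η k z a b * partialDeriv a f z * partialDeriv b g z

/-! ### The boundary matrix and the integrals -/

/-- The lower-triangular boundary matrix `K(λ)`: its diagonal consists of numerical polynomials,
the coefficients of `c` may be functions on the phase space. -/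
def matK (a d : ℂ[X]) (c : (Phase n → ℂ)[X]) (z : Phase n) : Matrix (Fin 2) (Fin 2) ℂ[X] :=
  !![a, 0; c.map (Pi.evalRingHom (fun _ : Phase n => ℂ) z), d]

/-- The coefficient `τ_l` of `λ^l` in `τ(λ) = tr K(λ) T(λ)`, as a function on the phase space. -/
def tauCoeff (α : ℂ) (a d : ℂ[X]) (c : (Phase n → ℂ)[X]) (l : ℕ) (z : Phase n) : ℂ :=
  (matK a d c z * matT α z).trace.coeff l

/-- The span, at a point, of the differentials of the coefficients of `det T(λ)`. -/
def casimirSpan (α : ℂ) (z : Phase n) : Submodule ℂ (Phase n →L[ℂ] ℂ) :=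
  Submodule.span ℂ (Set.range fun l : ℕ => fderiv ℂ (detCoeff (n := n) α l) z)

/-- The functions `H_1, …, H_n` are independent at `z` (modulo the Casimir functions, that is, as
functions on the common level set of the Casimir functions). -/
def IndependentAt (α : ℂ) (H : Fin n → Phase n → ℂ) (z : Phase n) : Prop :=
  LinearIndependent ℂ fun i => (casimirSpan α z).mkQ (fderiv ℂ (H i) z)

/-- The function `f` is dependent at `z` on `H_1, …, H_n` and the Casimir functions. -/
def DependentAt (α : ℂ) (H : Fin n → Phase n → ℂ) (f : Phase n → ℂ) (z : Phase n) : Prop :=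
  fderiv ℂ f z ∈ casimirSpan α z ⊔ Submodule.span ℂ (Set.range fun i => fderiv ℂ (H i) z)

/-- On the open set `U`, the coefficients `τ_{e 1}, …, τ_{e n}` are the only independent
dynamical coefficients of `τ(λ)`: at the points of a dense subset of `U` they are independent
modulo the Casimir functions, and every coefficient of `τ(λ)` depends on them and on the Casimir
functions. -/
def OnlyIndependentCoeffs (α : ℂ) (a d : ℂ[X]) (c : (Phase n → ℂ)[X]) (e : Fin n → ℕ)
    (U : Set (Phase n)) : Prop :=
  U ⊆ closure {z | z ∈ U ∧ IndependentAt α (fun i => tauCoeff α a d c (e i)) z ∧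
    ∀ l : ℕ, DependentAt α (fun i => tauCoeff α a d c (e i)) (tauCoeff α a d c l) z}

end

end ReflectionAlgebra

namespace ReflectionAlgebra

noncomputable section

variable {n : ℕ}

/-! ### Polynomials in two variables -/

/-! This is separation of variables, carried out on covectors at a generic point; for n = 0 there is
nothing to prove. Let ±r_1, …, ±r_n be the zeros of B(λ)/λ at a point, with the numbers r_j held
fixed under differentiation. For both brackets the dA(r_j) pair to zero with each other, so do the
dB(r_j), and dA(r_i) pairs to zero with dB(r_j) for i ≠ j. Hence any covectors w_j = s_j dA(r_j) +
t_j dB(r_j) are pairwise isotropic (`poisson_separated`).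

The coefficients of det T(λ) are Casimir functions of both brackets (`pairing_det`,
`poisson_casimir`). If the n covectors w_j are independent modulo the Casimir differentials and lie
in the span of those and of dH_1, …, dH_n, then by dimension they generate the dH_i modulo Casimirs,
and the H_i commute (`isotropic_of_span`). Independence is tested with k = 0 and η = 1, where
dA(r_j) pairs with dB(r_j) to -A(r_j) B'(r_j), generically nonzero (`pairing_AB_diag`); the given η
may vanish.

Where the w_j come from depends on K. If the diagonal of K is not identically zero, differentiate
τ(r_j): the differential of the coefficient of B drops out because B(r_j) = 0, and dA(-r_j) is
eliminated with the differential of det T(r_j). Generically s_j ≠ 0 (`bracket_eq_zero_of_diagonal`).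
If the diagonal is zero, τ = c B, and after division by the leading coefficient of c the monic
factor B has coefficients integral over functions of the τ_l; so generically dB_i lies in the span
of the dτ_l, and w_j = dB(r_j) serves (`exists_open_dB_mem`).

Genericity is Zariski open and the brackets of the H_i are continuous, so a nonzero bracket would
persist on an open set containing a generic point of the given dense set.

Evaluating the bivector on dA(x), dB(x), dC(x) by the generating functions requires that these
contain no monomials beyond those that `tensor` reads. This is proved by division with remainder by
B(λ), where ρ_k cancels exactly the excess terms. -/

lemma ev_lam (f : ℂ[X]) : ev f lam = C f := by
  induction f using Polynomial.induction_on' with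
  | add p q hp hq => simp_all [ev]
  | monomial m a => simp [ev, lam, ← C_mul_X_pow_eq_monomial]

lemma ev_mu (f : ℂ[X]) : ev f mu = f.map C := by
  induction f using Polynomial.induction_on' with
  | add p q hp hq => simp_all [ev]
  | monomial m a => simp [ev, mu, ← C_mul_X_pow_eq_monomial]

lemma ev_neg (f : ℂ[X]) (x : ℂ[X][X]) : ev f (-x) = ev (f.comp (-X)) x := by
  simp [ev, aeval_comp]

lemma divSub_mul {N : ℂ[X][X]} (h : N.eval X = 0) : divSub N * (C X - X) = N := by
  have := (mul_divByMonic_eq_iff_isRoot (p := N) (a := (X : ℂ[X]))).2 h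
  rw [divSub]
  linear_combination this

lemma divAdd_mul {N : ℂ[X][X]} (h : N.eval (-X) = 0) : divAdd N * (C X + X) = N := by
  have := (mul_divByMonic_eq_iff_isRoot (p := N) (a := (-X : ℂ[X]))).2 h
  rw [divAdd]
  simp only [map_neg] at this ⊢
  linear_combination this

lemma eval_map_C (f q : ℂ[X]) : (f.map C).eval q = f.comp q := by
  rw [eval_map]; rfl

lemma natDegree_sq_sub : (X ^ 2 - C (X ^ 2) : ℂ[X][X]).natDegree = 2 :=
  natDegree_X_pow_sub_C

/-- Up to sign the factor is monic of degree 2 in μ, so division by it lowers the μ-degree by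
exactly 2. -/
lemma coeff_eq_zero_of_mul_sq_sub {N E : ℂ[X][X]} (h : N * (C X ^ 2 - X ^ 2) = E) {d j : ℕ}
    (hE : E.natDegree ≤ d + 2) (hj : d < j) : N.coeff j = 0 := by
  have hm : (X ^ 2 - C (X ^ 2) : ℂ[X][X]).Monic := monic_X_pow_sub_C _ two_ne_zero
  by_cases hN : N = 0
  · simp [hN]
  have h' : N * (X ^ 2 - C (X ^ 2)) = -E := by rw [← h, map_pow]; ring
  have := congrArg natDegree h'
  rw [mul_comm, hm.natDegree_mul' hN, natDegree_neg, natDegree_sq_sub] at this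
  exact coeff_eq_zero_of_natDegree_lt (by omega)

lemma coeff_eq_zero_of_mul_add {N E : ℂ[X][X]} (h : N * (C X + X) = E) {d j : ℕ}
    (hE : E.natDegree ≤ d + 1) (hj : d < j) : N.coeff j = 0 := by
  by_cases hN : N = 0
  · simp [hN]
  have h' : N * (X + C X) = E := by rw [← h]; ring
  have := congrArg natDegree h'
  rw [mul_comm, (monic_X_add_C _).natDegree_mul' hN, natDegree_X_add_C] at this
  exact coeff_eq_zero_of_natDegree_lt (by omega)

lemma coeff_comp_neg {R : Type*} [CommRing R] (p : R[X]) (j : ℕ) :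
    (p.comp (-X)).coeff j = (-1) ^ j * p.coeff j := by
  have : (-X : R[X]) = C (-1) * X := by simp
  rw [this, comp_C_mul_X_coeff, mul_comm]

lemma coeff_eq_zero_of_odd {N : ℂ[X][X]} (h : N.comp (-X) = -N) {j : ℕ} (hj : Even j) :
    N.coeff j = 0 := by
  have := congrArg (fun p => p.coeff j) h
  simp only [coeff_comp_neg, hj.neg_one_pow, one_mul, coeff_neg] at this
  exact self_eq_neg.1 this

lemma sq_sub_ne_zero : (C X ^ 2 - X ^ 2 : ℂ[X][X]) ≠ 0 := by
  intro h
  have : (X ^ 2 - C (X ^ 2) : ℂ[X][X]) = 0 := by rw [map_pow]; linear_combination -h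
  exact (monic_X_pow_sub_C (X ^ 2 : ℂ[X]) two_ne_zero).ne_zero this

/-- The denominator λ² - μ² is even in μ, so the quotient inherits the parity of the numerator. -/
lemma odd_of_mul_sq_sub {N E : ℂ[X][X]} (h : N * (C X ^ 2 - X ^ 2) = E)
    (hE : E.comp (-X) = -E) : N.comp (-X) = -N := by
  apply mul_right_cancel₀ sq_sub_ne_zero
  rw [show -N * (C X ^ 2 - X ^ 2) = -E by rw [← h]; ring, ← hE, ← h]
  simp only [mul_comp, sub_comp, pow_comp, C_comp, X_comp]
  ring

lemma coeff_coeff_swap (N : ℂ[X][X]) (i j : ℕ) :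
    ((Bivariate.swap N).coeff i).coeff j = (N.coeff j).coeff i := by
  induction N using Polynomial.induction_on' with
  | add p q hp hq => simp_all
  | monomial m p =>
    induction p using Polynomial.induction_on' with
    | add p q hp hq => simp_all
    | monomial l a =>
      rw [Bivariate.swap_monomial_monomial]
      simp only [coeff_monomial]
      by_cases h1 : l = i <;> by_cases h2 : m = j <;> simp [h1, h2, coeff_monomial]

lemma eval_eq_sum_of_support {R κ : Type*} [CommRing R] [Fintype κ] (p : R[X]) (g : κ → ℕ)
    (hg : Function.Injective g) (h : ∀ j, j ∉ Set.range g → p.coeff j = 0) (y : R) :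
    p.eval y = ∑ b, p.coeff (g b) * y ^ g b := by
  classical
  rw [eval_eq_sum, Polynomial.sum,
    ← Finset.sum_image (s := Finset.univ) (g := g) (f := fun j => p.coeff j * y ^ j) hg.injOn]
  apply Finset.sum_subset
  · intro j hj
    by_contra hcon
    exact (mem_support_iff.1 hj) (h j (by simpa using hcon))
  · intro j _ hj
    simp [notMem_support_iff.1 hj]

/-- `tensor` keeps only finitely many listed coefficients; their sum recovers the generating
function because all the others vanish, separately in each variable. -/
lemma evalEval_eq_sum {ι κ : Type*} [Fintype ι] [Fintype κ] (N : ℂ[X][X]) (f : ι → ℕ) (g : κ → ℕ)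
    (hf : Function.Injective f) (hg : Function.Injective g)
    (h1 : ∀ i, i ∉ Set.range f → (Bivariate.swap N).coeff i = 0)
    (h2 : ∀ j, j ∉ Set.range g → N.coeff j = 0) (x y : ℂ) :
    N.evalEval x y = ∑ a, ∑ b, coeff₂ N (f a) (g b) * x ^ f a * y ^ g b := by
  rw [evalEval, eval_eq_sum_of_support N g hg h2, eval_finsetSum, Finset.sum_comm]
  refine Finset.sum_congr rfl fun b _ => ?_
  rw [eval_mul, eval_pow, eval_C, eval_eq_sum_of_support (N.coeff (g b)) f hf, Finset.sum_mul]
  · rfl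
  · intro i hi
    rw [← coeff_coeff_swap, h1 i hi, coeff_zero]

/-! ### Odd polynomials and the parity decomposition of `A(λ)` -/

/-- The odd polynomial `v_{n-1} λ^{2n-1} + ⋯ + v_0 λ`. -/
def oddPoly (v : Fin n → ℂ) : ℂ[X] := ∑ i : Fin n, C (v i) * X ^ (2 * (i : ℕ) + 1)

lemma oddPoly_comp (v : Fin n → ℂ) : (oddPoly v).comp (-X) = -oddPoly v := by
  simp [oddPoly, Polynomial.sum_comp, pow_succ, pow_mul]

lemma natDegree_oddPoly (v : Fin n → ℂ) : (oddPoly v).natDegree ≤ 2 * n - 1 := by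
  refine natDegree_sum_le_of_forall_le _ _ fun i _ => ?_
  exact (natDegree_C_mul_X_pow_le _ _).trans (by omega)

lemma polyB_eq (z : Phase n) :
    polyB z = X ^ (2 * n + 1) + oddPoly fun i => z (genB i) := rfl

lemma polyC_eq (z : Phase n) : polyC z = oddPoly fun i => z (genC i) := rfl

lemma polyB_comp (z : Phase n) : (polyB z).comp (-X) = -polyB z := by
  simp [polyB_eq, oddPoly_comp, pow_succ, pow_mul]
  ring

lemma polyC_comp (z : Phase n) : (polyC z).comp (-X) = -polyC z := by
  rw [polyC_eq, oddPoly_comp]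

lemma natDegree_polyB (z : Phase n) : (polyB z).natDegree ≤ 2 * n + 1 := by
  rw [polyB_eq]
  compute_degree
  have := natDegree_oddPoly fun i => z (genB i)
  omega

lemma natDegree_polyC (z : Phase n) : (polyC z).natDegree ≤ 2 * n - 1 := natDegree_oddPoly _

lemma sum_range_two_mul {M : Type*} [AddCommMonoid M] (f : ℕ → M) (n : ℕ) :
    ∑ i ∈ Finset.range (2 * n), f i = ∑ i ∈ Finset.range n, (f (2 * i) + f (2 * i + 1)) := by
  induction n with
  | zero => simp
  | succ n ih => rw [mul_add, Finset.sum_range_succ, Finset.sum_range_succ, ih,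
      Finset.sum_range_succ, add_assoc]

/-- The leading free coefficient `A_{2n}`. -/
def topA (z : Phase n) : ℂ := z (genA (Fin.last (2 * n)))

/-- The coefficients of `A` extended by zero. -/
def coordA (z : Phase n) (i : ℕ) : ℂ := if h : i < 2 * n + 1 then z (genA ⟨i, h⟩) else 0

/-- The even part of `A(λ)`. -/
def evenA (z : Phase n) : ℂ[X] :=
  C (topA z) * X ^ (2 * n) + ∑ i : Fin n, C (coordA z (2 * i)) * X ^ (2 * (i : ℕ))

/-- The odd part of `A(λ)`. -/
def oddA (α : ℂ) (z : Phase n) : ℂ[X] :=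
  C α * X ^ (2 * n + 1) + oddPoly (n := n) fun i => coordA z (2 * i + 1)

/-- The remainder of the odd part of `A(λ)` modulo `B(λ)`. -/
def remO (α : ℂ) (z : Phase n) : ℂ[X] :=
  oddPoly (n := n) fun i => coordA z (2 * i + 1) - α * z (genB i)

/-- The remainder of `λ` times the even part of `A(λ)` modulo `B(λ)`. -/
def remE (z : Phase n) : ℂ[X] :=
  oddPoly (n := n) fun i => coordA z (2 * i) - topA z * z (genB i)

lemma polyA_eq (α : ℂ) (z : Phase n) : polyA α z = evenA z + oddA α z := by
  have h : ∑ i : Fin (2 * n + 1), C (z (genA i)) * X ^ (i : ℕ)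
      = ∑ i ∈ Finset.range (2 * n + 1), C (coordA z i) * X ^ i := by
    rw [← Fin.sum_univ_eq_sum_range (fun i => C (coordA z i) * X ^ i) (2 * n + 1)]
    refine Finset.sum_congr rfl fun i _ => ?_
    simp [coordA, i.is_lt]
  have ht : coordA z (2 * n) = topA z := by simp [coordA, topA, Fin.last]
  rw [polyA, h, Finset.sum_range_succ, sum_range_two_mul, Finset.sum_add_distrib, ht, evenA, oddA,
    oddPoly, ← Fin.sum_univ_eq_sum_range (fun i => C (coordA z (2 * i)) * X ^ (2 * i)) n,
    ← Fin.sum_univ_eq_sum_range (fun i => C (coordA z (2 * i + 1)) * X ^ (2 * i + 1)) n]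
  ring

lemma polyA_comp (α : ℂ) (z : Phase n) : (polyA α z).comp (-X) = evenA z - oddA α z := by
  simp [polyA_eq, evenA, oddA, oddPoly_comp, Polynomial.sum_comp, pow_succ, pow_mul]
  ring

lemma oddA_eq (α : ℂ) (z : Phase n) : oddA α z = C α * polyB z + remO α z := by
  simp only [oddA, polyB_eq, remO, oddPoly, map_sub, map_mul, sub_mul, Finset.sum_sub_distrib,
    mul_add, Finset.mul_sum, mul_assoc]
  ring

lemma X_mul_evenA (z : Phase n) : X * evenA z = C (topA z) * polyB z + remE z := by
  simp only [evenA, polyB_eq, remE, oddPoly, map_sub, map_mul, sub_mul, Finset.sum_sub_distrib,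
    mul_add, Finset.mul_sum, mul_assoc, pow_succ, mul_left_comm X]
  simp only [mul_comm X]
  ring

/-! ### The generating functions without denominators -/

lemma smul_eq_CC (η : ℂ) (P : ℂ[X][X]) : η • P = C (C η) * P := by
  rw [Algebra.smul_def]; rfl

/-- The division by λ + μ is exact: the numerator vanishes at μ = -λ because B and C are odd and the
exponent 2k is even. -/
lemma brAA_mul (η : ℂ) (k : Fin 2) (z : Phase n) :
    brAA η k z * (C X + X) = C (C η) * (X ^ (2 * (k : ℕ)) * C (polyB z) * (polyC z).map C
      - C X ^ (2 * (k : ℕ)) * (polyB z).map C * C (polyC z)) := by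
  have h : eval (-X) (X ^ (2 * (k : ℕ)) * C (polyB z) * (polyC z).map C
      - C X ^ (2 * (k : ℕ)) * (polyB z).map C * C (polyC z)) = 0 := by
    simp only [eval_sub, eval_mul, eval_pow, eval_X, eval_C, eval_map_C, polyB_comp, polyC_comp,
      (even_two_mul (k : ℕ)).neg_pow]
    ring
  have e := divAdd_mul h
  simp only [brAA, ev_lam, ev_mu, smul_eq_CC]
  simp only [lam, mu]
  linear_combination C (C η) * e

lemma brAB_mul_raw (α η : ℂ) (k : Fin 2) (z : Phase n) :
    brAB α η k z * (C X ^ 2 - X ^ 2) = C (C η) * (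
      (C X ^ (2 * (k : ℕ)) * C (polyA α z) * (polyB z).map C
        - X ^ (2 * (k : ℕ)) * (polyA α z).map C * C (polyB z)) * (C X + X)
      + (C X ^ (2 * (k : ℕ)) * C (polyA α z) * (polyB z).map C
        + X ^ (2 * (k : ℕ)) * ((polyA α z).comp (-X)).map C * C (polyB z)) * (C X - X)
      - 2 * (C (rho α z k) * C (polyB z) * (polyB z).map C) * (C X ^ 2 - X ^ 2)) := by
  have h1 : eval X (C X ^ (2 * (k : ℕ)) * C (polyA α z) * (polyB z).map C
      - X ^ (2 * (k : ℕ)) * (polyA α z).map C * C (polyB z)) = 0 := by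
    simp only [eval_sub, eval_mul, eval_pow, eval_X, eval_C, eval_map_C, comp_X]
    ring
  have h2 : eval (-X) (C X ^ (2 * (k : ℕ)) * C (polyA α z) * (polyB z).map C
      + X ^ (2 * (k : ℕ)) * ((polyA α z).comp (-X)).map C * C (polyB z)) = 0 := by
    simp only [eval_add, eval_mul, eval_pow, eval_X, eval_C, eval_map_C, polyB_comp,
      (even_two_mul (k : ℕ)).neg_pow, comp_assoc, neg_comp, X_comp, neg_neg, comp_X]
    ring
  have e1 := divSub_mul h1
  have e2 := divAdd_mul h2
  simp only [brAB, ev_neg, ev_lam, ev_mu, smul_eq_CC, map_mul]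
  simp only [lam, mu, map_ofNat]
  linear_combination C (C η) * (C X + X) * e1 + C (C η) * (C X - X) * e2

lemma brAC_mul_raw (α η : ℂ) (k : Fin 2) (z : Phase n) :
    brAC α η k z * (C X ^ 2 - X ^ 2) = C (C η) * (
      -(X ^ (2 * (k : ℕ)) * C (polyA α z) * (polyC z).map C
        - C X ^ (2 * (k : ℕ)) * (polyA α z).map C * C (polyC z)) * (C X + X)
      - 2 * ((k : ℕ) : ℂ[X][X]) * (C X * C (polyA α z) * (polyC z).map C) * (C X ^ 2 - X ^ 2)
      - (X ^ (2 * (k : ℕ)) * C (polyA α z) * (polyC z).map C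
        + C X ^ (2 * (k : ℕ)) * ((polyA α z).comp (-X)).map C * C (polyC z)) * (C X - X)
      + 2 * (C (rho α z k) * C (polyB z) * (polyC z).map C) * (C X ^ 2 - X ^ 2)) := by
  have h1 : eval X (X ^ (2 * (k : ℕ)) * C (polyA α z) * (polyC z).map C
        - C X ^ (2 * (k : ℕ)) * (polyA α z).map C * C (polyC z)) = 0 := by
    simp only [eval_sub, eval_mul, eval_pow, eval_X, eval_C, eval_map_C, comp_X]
    ring
  have h2 : eval (-X) (X ^ (2 * (k : ℕ)) * C (polyA α z) * (polyC z).map C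
        + C X ^ (2 * (k : ℕ)) * ((polyA α z).comp (-X)).map C * C (polyC z)) = 0 := by
    simp only [eval_add, eval_mul, eval_pow, eval_X, eval_C, eval_map_C, polyC_comp,
      (even_two_mul (k : ℕ)).neg_pow, comp_assoc, neg_comp, X_comp, neg_neg, comp_X]
    ring
  have e1 := divSub_mul h1
  have e2 := divAdd_mul h2
  simp only [brAC, ev_neg, ev_lam, ev_mu, smul_eq_CC, map_mul]
  simp only [lam, mu, map_ofNat, map_natCast]
  linear_combination -C (C η) * (C X + X) * e1 - C (C η) * (C X - X) * e2

lemma brBC_mul_raw (α η : ℂ) (k : Fin 2) (z : Phase n) :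
    brBC α η k z * (C X ^ 2 - X ^ 2) = C (C η) * (
      C X ^ (2 * (k : ℕ)) * (C ((polyA α z).comp (-X)) * (polyA α z).map C
        - C (polyA α z) * ((polyA α z).comp (-X)).map C) * (C X + X)
      + C X ^ (2 * (k : ℕ)) * (C (polyA α z) * (polyA α z).map C
        - C ((polyA α z).comp (-X)) * ((polyA α z).comp (-X)).map C) * (C X - X)
      + 2 * (((rho α z k).map C * ((polyA α z).comp (-X)).map C
        - ((rho α z k).comp (-X)).map C * (polyA α z).map C) * C (polyB z))
          * (C X ^ 2 - X ^ 2)) := by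
  have h1 : eval X (C ((polyA α z).comp (-X)) * (polyA α z).map C
        - C (polyA α z) * ((polyA α z).comp (-X)).map C) = 0 := by
    simp only [eval_sub, eval_mul, eval_C, eval_map_C, comp_X]
    ring
  have h2 : eval (-X) (C (polyA α z) * (polyA α z).map C
        - C ((polyA α z).comp (-X)) * ((polyA α z).comp (-X)).map C) = 0 := by
    simp only [eval_sub, eval_mul, eval_C, eval_map_C, comp_assoc, neg_comp, X_comp, neg_neg,
      comp_X]
    ring
  have e1 := divSub_mul h1
  have e2 := divAdd_mul h2
  simp only [brBC, ev_neg, ev_lam, ev_mu, smul_eq_CC, map_mul]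
  simp only [lam, map_ofNat]
  linear_combination C (C η) * (C X + X) * C X ^ (2 * (k : ℕ)) * e1
    + C (C η) * (C X - X) * C X ^ (2 * (k : ℕ)) * e2

lemma brCC_raw (α η : ℂ) (k : Fin 2) (z : Phase n) :
    brCC α η k z = C (C η) * (
      2 * ((((rho α z k).comp (-X)).map C * (polyA α z).map C
        - (rho α z k).map C * ((polyA α z).comp (-X)).map C) * C (polyC z))
      - 2 * ((C ((rho α z k).comp (-X)) * C (polyA α z)
        - C (rho α z k) * C ((polyA α z).comp (-X))) * (polyC z).map C)) := by
  simp only [brCC, ev_neg, ev_lam, ev_mu, smul_eq_CC, map_mul]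
  simp only [map_ofNat]
  ring

/-! ### Supports of the generating functions -/

/-- The product `p(λ) q(μ)`. -/
def tens (p q : ℂ[X]) : ℂ[X][X] := C p * q.map C

/-- Polynomials of degree at most `d`. -/
def degLE (d : ℕ) : Submodule ℂ ℂ[X] where
  carrier := {p | p.natDegree ≤ d}
  add_mem' hp hq := natDegree_add_le_of_degree_le hp hq
  zero_mem' := by simp
  smul_mem' a _ hp := (natDegree_smul_le a _).trans hp

/-- Odd polynomials of degree at most `d`. -/
def oddLE (d : ℕ) : Submodule ℂ ℂ[X] where
  carrier := {p | p.natDegree ≤ d ∧ p.comp (-X) = -p}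
  add_mem' hp hq := ⟨natDegree_add_le_of_degree_le hp.1 hq.1, by
    rw [add_comp, hp.2, hq.2]; ring⟩
  zero_mem' := by simp
  smul_mem' a _ hp := ⟨(natDegree_smul_le a _).trans hp.1, by rw [smul_comp, hp.2, smul_neg]⟩

/-- The span of the products `p(λ) q(μ)` with `p ∈ P` and `q ∈ Q`. -/
def tensSpan (P Q : Submodule ℂ ℂ[X]) : Submodule ℂ ℂ[X][X] :=
  Submodule.span ℂ {E | ∃ p ∈ P, ∃ q ∈ Q, E = tens p q}

lemma tens_mem {P Q : Submodule ℂ ℂ[X]} {p q : ℂ[X]} (hp : p ∈ P) (hq : q ∈ Q) :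
    tens p q ∈ tensSpan P Q :=
  Submodule.subset_span ⟨p, hp, q, hq, rfl⟩

lemma swap_mem {P Q : Submodule ℂ ℂ[X]} {E : ℂ[X][X]} (hE : E ∈ tensSpan P Q) :
    Bivariate.swap E ∈ tensSpan Q P := by
  induction hE using Submodule.span_induction with
  | mem x hx =>
    obtain ⟨p, hp, q, hq, rfl⟩ := hx
    rw [tens, map_mul, Bivariate.swap_C, Bivariate.swap_map_C, mul_comm]
    exact tens_mem hq hp
  | zero => simp
  | add x y _ _ hx hy => rw [map_add]; exact add_mem hx hy
  | smul a x _ hx => rw [map_smul]; exact Submodule.smul_mem _ _ hx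

lemma natDegree_le_of_mem {P : Submodule ℂ ℂ[X]} {d : ℕ} {E : ℂ[X][X]}
    (hE : E ∈ tensSpan P (degLE d)) : E.natDegree ≤ d := by
  induction hE using Submodule.span_induction with
  | mem x hx =>
    obtain ⟨p, -, q, hq, rfl⟩ := hx
    exact (natDegree_C_mul_le _ _).trans (natDegree_map_le.trans hq)
  | zero => simp
  | add x y _ _ hx hy => exact natDegree_add_le_of_degree_le hx hy
  | smul a x _ hx => exact (natDegree_smul_le a _).trans hx

lemma tensSpan_mono {P Q P' Q' : Submodule ℂ ℂ[X]} (hP : P ≤ P') (hQ : Q ≤ Q') :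
    tensSpan P Q ≤ tensSpan P' Q' :=
  Submodule.span_mono fun _ ⟨p, hp, q, hq, h⟩ => ⟨p, hP hp, q, hQ hq, h⟩

lemma oddLE_le (d : ℕ) : oddLE d ≤ degLE d := fun _ h => h.1

lemma odd_of_mem {P : Submodule ℂ ℂ[X]} {d : ℕ} {E : ℂ[X][X]}
    (hE : E ∈ tensSpan P (oddLE d)) : E.comp (-X) = -E := by
  induction hE using Submodule.span_induction with
  | mem x hx =>
    obtain ⟨p, -, q, hq, rfl⟩ := hx
    have : (q.map C).comp (-X) = -(q.map C) := by
      have := congrArg (Polynomial.map (C : ℂ →+* ℂ[X])) hq.2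
      simpa [Polynomial.map_comp] using this
    rw [tens, mul_comp, C_comp, this]
    ring
  | zero => simp
  | add x y _ _ hx hy => rw [add_comp, hx, hy]; ring
  | smul a x _ hx => rw [smul_comp, hx, smul_neg]

/-- Degree 2n + 2 drops to 2n under division by λ² - μ²: precisely the indices of A_0, …, A_{2n}
survive. -/
lemma coeff_eq_zero_of_deg {N E : ℂ[X][X]} (h : N * (C X ^ 2 - X ^ 2) = E)
    {P : Submodule ℂ ℂ[X]} (hE : E ∈ tensSpan P (degLE (2 * n + 2))) (i : ℕ)
    (hi : i ∉ Set.range (fun a : Fin (2 * n + 1) => (a : ℕ))) : N.coeff i = 0 := by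
  refine coeff_eq_zero_of_mul_sq_sub h (natDegree_le_of_mem hE) ?_
  by_contra hcon
  exact hi ⟨⟨i, by omega⟩, rfl⟩

/-- Parity kills the even powers and the degree drops from 2n + 1 to 2n - 1, which leaves the
indices of the free coefficients of B and C. -/
lemma coeff_eq_zero_of_odd_deg {N E : ℂ[X][X]} (h : N * (C X ^ 2 - X ^ 2) = E)
    {P : Submodule ℂ ℂ[X]} (hE : E ∈ tensSpan P (oddLE (2 * n + 1))) (i : ℕ)
    (hi : i ∉ Set.range (fun a : Fin n => 2 * (a : ℕ) + 1)) : N.coeff i = 0 := by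
  rcases Nat.even_or_odd i with he | ⟨j, rfl⟩
  · exact coeff_eq_zero_of_odd (odd_of_mul_sq_sub h (odd_of_mem hE)) he
  · refine coeff_eq_zero_of_mul_sq_sub (d := 2 * n - 1) h
      ((natDegree_le_of_mem (tensSpan_mono le_rfl (oddLE_le _) hE)).trans (by omega)) ?_
    by_contra hcon
    exact hi ⟨⟨j, by omega⟩, rfl⟩

lemma swap_mul_sq_sub {N E : ℂ[X][X]} (h : N * (C X ^ 2 - X ^ 2) = E) :
    Bivariate.swap N * (C X ^ 2 - X ^ 2) = -Bivariate.swap E := by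
  rw [← h]
  simp only [map_mul, map_sub, map_pow, Bivariate.swap_X, Bivariate.swap_Y]
  ring

lemma injective_odd : Function.Injective (fun a : Fin n => 2 * (a : ℕ) + 1) := by
  intro a b h
  ext
  simpa using h

lemma sum_deg_odd {N E : ℂ[X][X]} (h : N * (C X ^ 2 - X ^ 2) = E)
    (hE : E ∈ tensSpan (degLE (2 * n + 2)) (oddLE (2 * n + 1))) (x y : ℂ) :
    N.evalEval x y = ∑ a : Fin (2 * n + 1), ∑ b : Fin n,
      coeff₂ N a (2 * b + 1) * x ^ (a : ℕ) * y ^ (2 * (b : ℕ) + 1) :=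
  evalEval_eq_sum N _ _ Fin.val_injective injective_odd
    (coeff_eq_zero_of_deg (swap_mul_sq_sub h) (neg_mem (swap_mem hE)))
    (coeff_eq_zero_of_odd_deg h hE) x y

lemma sum_odd_odd {N E : ℂ[X][X]} (h : N * (C X ^ 2 - X ^ 2) = E)
    (hE : E ∈ tensSpan (oddLE (2 * n + 1)) (oddLE (2 * n + 1))) (x y : ℂ) :
    N.evalEval x y = ∑ a : Fin n, ∑ b : Fin n,
      coeff₂ N (2 * a + 1) (2 * b + 1) * x ^ (2 * (a : ℕ) + 1) * y ^ (2 * (b : ℕ) + 1) :=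
  evalEval_eq_sum N _ _ injective_odd injective_odd
    (coeff_eq_zero_of_odd_deg (swap_mul_sq_sub h) (neg_mem (swap_mem hE)))
    (coeff_eq_zero_of_odd_deg h hE) x y

lemma sum_deg_deg {N E : ℂ[X][X]} (h : N * (C X + X) = E)
    (hE : E ∈ tensSpan (degLE (2 * n + 1)) (degLE (2 * n + 1))) (x y : ℂ) :
    N.evalEval x y = ∑ a : Fin (2 * n + 1), ∑ b : Fin (2 * n + 1),
      coeff₂ N a b * x ^ (a : ℕ) * y ^ (b : ℕ) := by
  have hs : Bivariate.swap N * (C X + X) = Bivariate.swap E := by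
    rw [← h]
    simp only [map_mul, map_add, Bivariate.swap_X, Bivariate.swap_Y]
    ring
  have key : ∀ {N E : ℂ[X][X]}, N * (C X + X) = E →
      E ∈ tensSpan (degLE (2 * n + 1)) (degLE (2 * n + 1)) → ∀ i,
      i ∉ Set.range (fun a : Fin (2 * n + 1) => (a : ℕ)) → N.coeff i = 0 := by
    intro N E h hE i hi
    refine coeff_eq_zero_of_mul_add h (natDegree_le_of_mem hE) ?_
    by_contra hcon
    exact hi ⟨⟨i, by omega⟩, rfl⟩
  exact evalEval_eq_sum N _ _ Fin.val_injective Fin.val_injective (key hs (swap_mem hE))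
    (key h hE) x y

/-! ### Generating functions in terms of the remainders of A(λ) modulo B(λ) -/

/-- The polynomial `α λ + A_{2n}`. -/
def linA (α : ℂ) (z : Phase n) : ℂ[X] := C α * X + C (topA z)

/-- The combination `α w - A_{2n} u` of the remainders of `A(λ)` modulo `B(λ)`. -/
def remH (α : ℂ) (z : Phase n) : ℂ[X] := C α * remE z - C (topA z) * remO α z

lemma rho_zero (α : ℂ) (z : Phase n) : rho α z 0 = 0 := rfl

lemma rho_one (α : ℂ) (z : Phase n) : rho α z 1 = linA α z := rfl

lemma remO_mem (α : ℂ) (z : Phase n) : remO α z ∈ oddLE (2 * n - 1) :=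
  ⟨natDegree_oddPoly _, oddPoly_comp _⟩

lemma remE_mem (z : Phase n) : remE z ∈ oddLE (2 * n - 1) :=
  ⟨natDegree_oddPoly _, oddPoly_comp _⟩

lemma remH_mem (α : ℂ) (z : Phase n) : remH α z ∈ oddLE (2 * n - 1) := by
  rw [remH, ← smul_eq_C_mul, ← smul_eq_C_mul]
  exact sub_mem (Submodule.smul_mem _ _ (remE_mem z)) (Submodule.smul_mem _ _ (remO_mem α z))

lemma polyC_mem (z : Phase n) : polyC z ∈ oddLE (2 * n - 1) :=
  ⟨natDegree_polyC z, polyC_comp z⟩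

lemma polyB_mem (z : Phase n) : polyB z ∈ oddLE (2 * n + 1) :=
  ⟨natDegree_polyB z, polyB_comp z⟩

lemma natDegree_linA (α : ℂ) (z : Phase n) : (linA α z).natDegree ≤ 1 := natDegree_linear_le

lemma mul_mem_degLE {p q : ℂ[X]} {d e : ℕ} (hp : p.natDegree ≤ d) (hq : q.natDegree ≤ e) :
    p * q ∈ degLE (d + e) := natDegree_mul_le_of_le hp hq

lemma X_pow_mul_mem {d : ℕ} {p : ℂ[X]} (hp : p ∈ oddLE d) (k : Fin 2) :
    X ^ (2 * (k : ℕ)) * p ∈ oddLE (d + 2) := by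
  refine ⟨(natDegree_mul_le_of_le (natDegree_X_pow_le _) hp.1).trans (by omega), ?_⟩
  rw [mul_comp, hp.2, pow_comp, X_comp, (even_two_mul (k : ℕ)).neg_pow]
  ring

lemma degLE_mono {d e : ℕ} (h : d ≤ e) : degLE d ≤ degLE e := fun _ hp => le_trans hp h

lemma oddLE_mono {d e : ℕ} (h : d ≤ e) : oddLE d ≤ oddLE e := fun _ hp => ⟨le_trans hp.1 h, hp.2⟩

section relations

variable (α : ℂ) (z : Phase n)

lemma C_polyA : (C (polyA α z) : ℂ[X][X]) = C (evenA z) + C (oddA α z) := by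
  rw [polyA_eq, map_add]

lemma C_polyA_comp : (C ((polyA α z).comp (-X)) : ℂ[X][X]) = C (evenA z) - C (oddA α z) := by
  rw [polyA_comp, map_sub]

lemma map_polyA : (polyA α z).map (C : ℂ →+* ℂ[X]) = (evenA z).map C + (oddA α z).map C := by
  rw [polyA_eq, Polynomial.map_add]

lemma map_polyA_comp :
    ((polyA α z).comp (-X)).map (C : ℂ →+* ℂ[X]) = (evenA z).map C - (oddA α z).map C := by
  rw [polyA_comp, Polynomial.map_sub]

lemma C_oddA : (C (oddA α z) : ℂ[X][X]) = C (C α) * C (polyB z) + C (remO α z) := by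
  rw [oddA_eq, map_add, map_mul]

lemma map_oddA : (oddA α z).map (C : ℂ →+* ℂ[X])
    = C (C α) * (polyB z).map C + (remO α z).map C := by
  rw [oddA_eq, Polynomial.map_add, Polynomial.map_mul, map_C]

lemma C_evenA : (C X * C (evenA z) : ℂ[X][X]) = C (C (topA z)) * C (polyB z) + C (remE z) := by
  rw [← map_mul, X_mul_evenA, map_add, map_mul]

lemma map_evenA : X * (evenA z).map (C : ℂ →+* ℂ[X])
    = C (C (topA z)) * (polyB z).map C + (remE z).map C := by
  have := congrArg (Polynomial.map (C : ℂ →+* ℂ[X])) (X_mul_evenA z)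
  simpa using this

end relations

lemma brAA_mul_eq (η : ℂ) (k : Fin 2) (z : Phase n) :
    brAA η k z * (C X + X) = η • (tens (polyB z) (X ^ (2 * (k : ℕ)) * polyC z)
      - tens (X ^ (2 * (k : ℕ)) * polyC z) (polyB z)) := by
  rw [brAA_mul, smul_eq_CC]
  simp only [tens, map_mul, map_pow, Polynomial.map_mul, Polynomial.map_pow, map_X]
  ring

/-- Dividing the parity parts of A by B leaves the excess term (λ^{2k} - μ^{2k})(αλ + A_{2n}) B(λ)
B(μ); it equals (λ² - μ²) ρ_k(λ) B(λ) B(μ) and is cancelled by the ρ_k term. Only remainders of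
degree at most 2n - 1 stay next to B, which gives the degree bounds. -/
lemma brAB_mul (α η : ℂ) (k : Fin 2) (z : Phase n) :
    brAB α η k z * (C X ^ 2 - X ^ 2) = (2 * η) • (
      tens (X ^ (2 * (k : ℕ)) * remE z) (polyB z)
      + tens (X * (X ^ (2 * (k : ℕ)) * remO α z)) (polyB z)
      - tens (polyB z) (X ^ (2 * (k : ℕ)) * remE z)
      - tens (X * polyB z) (X ^ (2 * (k : ℕ)) * remO α z)) := by
  rw [brAB_mul_raw, smul_eq_CC]
  simp only [tens, map_mul, map_pow, Polynomial.map_mul, Polynomial.map_pow, map_X, C_polyA,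
    map_polyA, map_polyA_comp, map_ofNat]
  have hk : C (rho α z k) * (C (polyB z) * (polyB z).map C) * (C X ^ 2 - X ^ 2)
      = (C X ^ (2 * (k : ℕ)) - X ^ (2 * (k : ℕ)))
        * ((C (C α) * C X + C (C (topA z))) * C (polyB z) * (polyB z).map C) := by
    fin_cases k
    · simp [rho_zero]
    · simp [rho_one, linA]
      ring
  linear_combination
    2 * C (C η) * C X ^ (2 * (k : ℕ)) * (polyB z).map C * (C X * C_oddA α z + C_evenA z)
    - 2 * C (C η) * X ^ (2 * (k : ℕ)) * C (polyB z) * (C X * map_oddA α z + map_evenA z)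
    - 2 * C (C η) * hk

lemma brAC_mul (α η : ℂ) (k : Fin 2) (z : Phase n) :
    brAC α η k z * (C X ^ 2 - X ^ 2) = (-2 * η) • (
      tens (linA α z * polyB z) (X ^ (2 * (k : ℕ)) * polyC z)
      + tens (X ^ (2 * (k : ℕ)) * remE z) (polyC z)
      + tens (X * (X ^ (2 * (k : ℕ)) * remO α z)) (polyC z)
      - tens (linA α z * (X ^ (2 * (k : ℕ)) * polyC z)) (polyB z)
      - tens (X ^ (2 * (k : ℕ)) * polyC z) (remE z)
      - tens (X * (X ^ (2 * (k : ℕ)) * polyC z)) (remO α z)) := by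
  rw [brAC_mul_raw, smul_eq_CC]
  simp only [tens, map_mul, map_pow, Polynomial.map_mul, Polynomial.map_pow, map_X, C_polyA,
    map_polyA, map_polyA_comp, map_ofNat, linA, map_add, map_neg]
  have hk : C (rho α z k) * (C X ^ 2 - X ^ 2)
      = (C X ^ (2 * (k : ℕ)) - X ^ (2 * (k : ℕ)))
        * ((C (C α) * C X + C (C (topA z)))) := by
    fin_cases k
    · simp [rho_zero]
    · simp [rho_one, linA]
      ring
  have hk' : ((k : ℕ) : ℂ[X][X]) * (C X ^ 2 - X ^ 2) = C X ^ (2 * (k : ℕ)) - X ^ (2 * (k : ℕ)) := by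
    fin_cases k <;> simp
  linear_combination
    -2 * C (C η) * C X ^ (2 * (k : ℕ)) * (polyC z).map C * (C X * C_oddA α z + C_evenA z)
    + 2 * C (C η) * C X ^ (2 * (k : ℕ)) * C (polyC z) * (C X * map_oddA α z + map_evenA z)
    - 2 * C (C η) * C X * (C (evenA z) + C (oddA α z)) * (polyC z).map C * hk'
    + 2 * C (C η) * C (polyB z) * (polyC z).map C * hk

lemma brBC_mul (α η : ℂ) (k : Fin 2) (z : Phase n) :
    brBC α η k z * (C X ^ 2 - X ^ 2) = (4 * η) • (
      tens (X ^ (2 * (k : ℕ)) * remH α z) (polyB z)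
      - tens (polyB z) (X ^ (2 * (k : ℕ)) * remH α z)
      + tens (X ^ (2 * (k : ℕ)) * remE z) (remO α z)
      - tens (X ^ (2 * (k : ℕ)) * remO α z) (remE z)) := by
  rw [brBC_mul_raw, smul_eq_CC]
  simp only [tens, map_mul, map_pow, Polynomial.map_mul, Polynomial.map_pow, map_X, C_polyA,
    map_polyA, map_polyA_comp, C_polyA_comp, map_ofNat, remH, map_sub, Polynomial.map_sub, map_C]
  have hk : ((rho α z k).map C * ((evenA z).map C - (oddA α z).map C)
      - ((rho α z k).comp (-X)).map C * ((evenA z).map C + (oddA α z).map C))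
        * (C X ^ 2 - X ^ 2)
      = (C X ^ (2 * (k : ℕ)) - X ^ (2 * (k : ℕ)))
        * (2 * (C (C α) * X * (evenA z).map C - C (C (topA z)) * (oddA α z).map C)) := by
    fin_cases k
    · simp [rho_zero]
    · simp [rho_one, linA]
      ring
  linear_combination
    4 * C (C η) * C X ^ (2 * (k : ℕ)) * ((oddA α z).map C * C_evenA z
      + (C (C (topA z)) * C (polyB z) + C (remE z)) * map_oddA α z
      - X * (evenA z).map C * C_oddA α z
      - (C (C α) * C (polyB z) + C (remO α z)) * map_evenA z)
    + 4 * C (C η) * (C X ^ (2 * (k : ℕ)) - X ^ (2 * (k : ℕ))) * C (polyB z)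
      * (C (C α) * map_evenA z - C (C (topA z)) * map_oddA α z)
    + 2 * C (C η) * C (polyB z) * hk

/-- In the combination of ρ_1(±μ) and A(±μ) the multiples of B(μ) cancel, leaving the remainder
`remH`; for k = 0 both sides vanish. -/
lemma brCC_eq (α η : ℂ) (k : Fin 2) (z : Phase n) :
    brCC α η k z = (4 * η * ((k : ℕ) : ℂ)) • (
      tens (remH α z) (polyC z) - tens (polyC z) (remH α z)) := by
  rw [brCC_raw, smul_eq_CC]
  simp only [tens, map_mul, C_polyA, map_polyA, map_polyA_comp, C_polyA_comp, map_ofNat, remH,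
    map_sub, Polynomial.map_sub, map_C, Polynomial.map_mul, map_natCast]
  fin_cases k
  · simp [rho_zero]
  · simp [rho_one, linA]
    linear_combination
      4 * C (C η) * C (polyC z) * (C (C (topA z)) * map_oddA α z - C (C α) * map_evenA z)
      - 4 * C (C η) * (polyC z).map C * (C (C (topA z)) * C_oddA α z - C (C α) * C_evenA z)

/-! ### The supports -/

section supports

variable (hn : 1 ≤ n) (α η : ℂ) (k : Fin 2) (z : Phase n)
include hn

lemma brAA_mem : η • (tens (polyB z) (X ^ (2 * (k : ℕ)) * polyC z)
      - tens (X ^ (2 * (k : ℕ)) * polyC z) (polyB z))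
      ∈ tensSpan (degLE (2 * n + 1)) (degLE (2 * n + 1)) := by
  have hC : X ^ (2 * (k : ℕ)) * polyC z ∈ degLE (2 * n + 1) :=
    degLE_mono (by omega) (oddLE_le _ (X_pow_mul_mem (polyC_mem z) k))
  have hB : polyB z ∈ degLE (2 * n + 1) := natDegree_polyB z
  exact Submodule.smul_mem _ _ (sub_mem (tens_mem hB hC) (tens_mem hC hB))

lemma X_pow_mul_mem_odd {p : ℂ[X]} (hp : p ∈ oddLE (2 * n - 1)) :
    X ^ (2 * (k : ℕ)) * p ∈ oddLE (2 * n + 1) :=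
  oddLE_mono (by omega) (X_pow_mul_mem hp k)

lemma brAB_mem : (2 * η) • (
      tens (X ^ (2 * (k : ℕ)) * remE z) (polyB z)
      + tens (X * (X ^ (2 * (k : ℕ)) * remO α z)) (polyB z)
      - tens (polyB z) (X ^ (2 * (k : ℕ)) * remE z)
      - tens (X * polyB z) (X ^ (2 * (k : ℕ)) * remO α z))
      ∈ tensSpan (degLE (2 * n + 2)) (oddLE (2 * n + 1)) := by
  have hE := X_pow_mul_mem_odd hn k (remE_mem z)
  have hO := X_pow_mul_mem_odd hn k (remO_mem α z)
  have hB := polyB_mem z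
  have up : ∀ {p : ℂ[X]}, p ∈ oddLE (2 * n + 1) → p ∈ degLE (2 * n + 2) :=
    fun h => degLE_mono (by omega) (oddLE_le _ h)
  have upX : ∀ {p : ℂ[X]}, p ∈ oddLE (2 * n + 1) → X * p ∈ degLE (2 * n + 2) :=
    fun h => degLE_mono (by omega) (mul_mem_degLE natDegree_X_le h.1)
  exact Submodule.smul_mem _ _ (sub_mem (sub_mem (add_mem (tens_mem (up hE) hB)
    (tens_mem (upX hO) hB)) (tens_mem (up hB) hE)) (tens_mem (upX hB) hO))

lemma brAC_mem : (-2 * η) • (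
      tens (linA α z * polyB z) (X ^ (2 * (k : ℕ)) * polyC z)
      + tens (X ^ (2 * (k : ℕ)) * remE z) (polyC z)
      + tens (X * (X ^ (2 * (k : ℕ)) * remO α z)) (polyC z)
      - tens (linA α z * (X ^ (2 * (k : ℕ)) * polyC z)) (polyB z)
      - tens (X ^ (2 * (k : ℕ)) * polyC z) (remE z)
      - tens (X * (X ^ (2 * (k : ℕ)) * polyC z)) (remO α z))
      ∈ tensSpan (degLE (2 * n + 2)) (oddLE (2 * n + 1)) := by
  have hE := X_pow_mul_mem_odd hn k (remE_mem z)
  have hO := X_pow_mul_mem_odd hn k (remO_mem α z)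
  have hC := X_pow_mul_mem_odd hn k (polyC_mem z)
  have hB := polyB_mem z
  have lo : ∀ {p : ℂ[X]}, p ∈ oddLE (2 * n - 1) → p ∈ oddLE (2 * n + 1) :=
    fun h => oddLE_mono (by omega) h
  have up : ∀ {p : ℂ[X]}, p ∈ oddLE (2 * n + 1) → p ∈ degLE (2 * n + 2) :=
    fun h => degLE_mono (by omega) (oddLE_le _ h)
  have upX : ∀ {p : ℂ[X]}, p ∈ oddLE (2 * n + 1) → X * p ∈ degLE (2 * n + 2) :=
    fun h => degLE_mono (by omega) (mul_mem_degLE natDegree_X_le h.1)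
  have upL : ∀ {p : ℂ[X]}, p ∈ oddLE (2 * n + 1) → linA α z * p ∈ degLE (2 * n + 2) :=
    fun h => degLE_mono (by omega) (mul_mem_degLE (natDegree_linA α z) h.1)
  exact Submodule.smul_mem _ _ (sub_mem (sub_mem (sub_mem (add_mem (add_mem
    (tens_mem (upL hB) hC) (tens_mem (up hE) (lo (polyC_mem z))))
    (tens_mem (upX hO) (lo (polyC_mem z)))) (tens_mem (upL hC) hB))
    (tens_mem (up hC) (lo (remE_mem z)))) (tens_mem (upX hC) (lo (remO_mem α z))))

lemma brBC_mem : (4 * η) • (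
      tens (X ^ (2 * (k : ℕ)) * remH α z) (polyB z)
      - tens (polyB z) (X ^ (2 * (k : ℕ)) * remH α z)
      + tens (X ^ (2 * (k : ℕ)) * remE z) (remO α z)
      - tens (X ^ (2 * (k : ℕ)) * remO α z) (remE z))
      ∈ tensSpan (oddLE (2 * n + 1)) (oddLE (2 * n + 1)) := by
  have hE := X_pow_mul_mem_odd hn k (remE_mem z)
  have hO := X_pow_mul_mem_odd hn k (remO_mem α z)
  have hH := X_pow_mul_mem_odd hn k (remH_mem α z)
  have hB := polyB_mem z
  have lo : ∀ {p : ℂ[X]}, p ∈ oddLE (2 * n - 1) → p ∈ oddLE (2 * n + 1) :=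
    fun h => oddLE_mono (by omega) h
  exact Submodule.smul_mem _ _ (sub_mem (add_mem (sub_mem (tens_mem hH hB) (tens_mem hB hH))
    (tens_mem hE (lo (remO_mem α z)))) (tens_mem hO (lo (remE_mem z))))

/-- `brCC` has no denominator. Multiplying it by λ² - μ² puts it into the form required by the
common support criterion `sum_odd_odd`. -/
lemma sq_sub_mul_tens_mem {p q : ℂ[X]} (hp : p ∈ oddLE (2 * n - 1)) (hq : q ∈ oddLE (2 * n - 1)) :
    tens p q * (C X ^ 2 - X ^ 2) ∈ tensSpan (oddLE (2 * n + 1)) (oddLE (2 * n + 1)) := by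
  have h : tens p q * (C X ^ 2 - X ^ 2)
      = tens (X ^ (2 * ((1 : Fin 2) : ℕ)) * p) q - tens p (X ^ (2 * ((1 : Fin 2) : ℕ)) * q) := by
    simp only [tens, map_mul, map_pow, Polynomial.map_mul, Polynomial.map_pow, map_X]
    norm_num
    ring
  rw [h]
  have lo : ∀ {p : ℂ[X]}, p ∈ oddLE (2 * n - 1) → p ∈ oddLE (2 * n + 1) :=
    fun h => oddLE_mono (by omega) h
  exact sub_mem (tens_mem (X_pow_mul_mem_odd hn 1 hp) (lo hq))
    (tens_mem (lo hp) (X_pow_mul_mem_odd hn 1 hq))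

lemma brCC_mem : brCC α η k z * (C X ^ 2 - X ^ 2)
    ∈ tensSpan (oddLE (2 * n + 1)) (oddLE (2 * n + 1)) := by
  rw [brCC_eq, smul_mul_assoc, sub_mul]
  exact Submodule.smul_mem _ _ (sub_mem (sq_sub_mul_tens_mem hn (remH_mem α z) (polyC_mem z))
    (sq_sub_mul_tens_mem hn (polyC_mem z) (remH_mem α z)))

end supports

/-! ### The Poisson bivector on covectors -/

/-- The bivector of the bracket `{·,·}_k`, as a bilinear form on covectors. -/
def pairing (α η : ℂ) (k : Fin 2) (z : Phase n) : LinearMap.BilinForm ℂ (Gen n → ℂ) :=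
  Matrix.toBilin' (tensor α η k z)

/-- The differential of `A(x)`. -/
def covA (x : ℂ) : Gen n → ℂ := Sum.elim (fun i => x ^ (i : ℕ)) fun _ => 0

/-- The differential of `B(x)`. -/
def covB (x : ℂ) : Gen n → ℂ :=
  Sum.elim (fun _ => 0) (Sum.elim (fun i => x ^ (2 * (i : ℕ) + 1)) fun _ => 0)

/-- The differential of `C(x)`. -/
def covC (x : ℂ) : Gen n → ℂ :=
  Sum.elim (fun _ => 0) (Sum.elim (fun _ => 0) fun i => x ^ (2 * (i : ℕ) + 1))

/-- The differential of `det T(x)`. -/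
def covDet (α : ℂ) (z : Phase n) (x : ℂ) : Gen n → ℂ :=
  (polyA α z).eval (-x) • covA x + (polyA α z).eval x • covA (-x)
    - (polyC z).eval x • covB x - (polyB z).eval x • covC x

lemma pairing_apply (α η : ℂ) (k : Fin 2) (z : Phase n) (u v : Gen n → ℂ) :
    pairing α η k z u v = ∑ a, ∑ b, u a * tensor α η k z a b * v b :=
  Matrix.toBilin'_apply _ _ _

lemma two_eq_CC : (2 : ℂ[X][X]) = C (C 2) := by
  rw [map_ofNat C, map_ofNat C]

lemma polyB_eval_neg (z : Phase n) (x : ℂ) : (polyB z).eval (-x) = -(polyB z).eval x := by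
  have := congrArg (eval x) (polyB_comp z)
  simpa [eval_comp] using this

lemma polyC_eval_neg (z : Phase n) (x : ℂ) : (polyC z).eval (-x) = -(polyC z).eval x := by
  have := congrArg (eval x) (polyC_comp z)
  simpa [eval_comp] using this

/-- Exchanging λ and μ negates the numerator and fixes the denominator λ + μ. -/
lemma brAA_swap (η : ℂ) (k : Fin 2) (z : Phase n) :
    Bivariate.swap (brAA η k z) = -brAA η k z := by
  have hne : (C X + X : ℂ[X][X]) ≠ 0 := by
    intro h
    exact (monic_X_add_C (X : ℂ[X])).ne_zero (by rw [← h]; ring)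
  apply mul_right_cancel₀ hne
  have h := brAA_mul η k z
  have h' := congrArg Bivariate.swap h
  simp only [map_mul, map_add, map_sub, map_pow, Bivariate.swap_Y,
    Bivariate.swap_C, Bivariate.swap_map_C, map_X, map_C] at h'
  linear_combination h' + h

lemma brCC_swap (α η : ℂ) (k : Fin 2) (z : Phase n) :
    Bivariate.swap (brCC α η k z) = -brCC α η k z := by
  rw [brCC_eq, map_smul]
  simp only [tens, map_mul, map_sub, Bivariate.swap_C, Bivariate.swap_map_C, ← smul_neg]
  congr 1
  ring

lemma coeff₂_antisymm {N : ℂ[X][X]} (h : Bivariate.swap N = -N) (i j : ℕ) :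
    coeff₂ N i j = -coeff₂ N j i := by
  have := coeff_coeff_swap N i j
  rw [h] at this
  simp only [coeff_neg] at this
  exact this.symm

lemma tensor_antisymm (α η : ℂ) (k : Fin 2) (z : Phase n) (a b : Gen n) :
    tensor α η k z a b = -tensor α η k z b a := by
  rcases a with i | i | i <;> rcases b with j | j | j <;> simp only [tensor, neg_neg, neg_zero]
  · exact coeff₂_antisymm (brAA_swap η k z) _ _
  · exact coeff₂_antisymm (brCC_swap α η k z) _ _

lemma pairing_antisymm (α η : ℂ) (k : Fin 2) (z : Phase n) (u v : Gen n → ℂ) :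
    pairing α η k z u v = -pairing α η k z v u := by
  rw [pairing_apply, pairing_apply, Finset.sum_comm, ← Finset.sum_neg_distrib]
  refine Finset.sum_congr rfl fun a _ => ?_
  rw [← Finset.sum_neg_distrib]
  refine Finset.sum_congr rfl fun b _ => ?_
  rw [tensor_antisymm]
  ring

lemma pairing_BB (α η : ℂ) (k : Fin 2) (z : Phase n) (x y : ℂ) :
    pairing α η k z (covB x) (covB y) = 0 := by
  simp [pairing_apply, Fintype.sum_sum_type, covB, tensor]

/-! ### Values of the bivector on the differentials of A(x), B(x), C(x) -/

section values

variable (hn : 1 ≤ n) (α η : ℂ) (k : Fin 2) (z : Phase n) (x y : ℂ)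
include hn

lemma pairing_AA_eq : pairing α η k z (covA x) (covA y) = (brAA η k z).evalEval x y := by
  rw [sum_deg_deg (brAA_mul_eq η k z) (brAA_mem hn η k z)]
  simp only [pairing_apply, Fintype.sum_sum_type, covA, tensor, Sum.elim_inl, Sum.elim_inr,
    mul_zero, zero_mul, Finset.sum_const_zero, add_zero]
  exact Finset.sum_congr rfl fun _ _ => Finset.sum_congr rfl fun _ _ => by ring

lemma pairing_AB_eq : pairing α η k z (covA x) (covB y) = (brAB α η k z).evalEval x y := by
  rw [sum_deg_odd (brAB_mul α η k z) (brAB_mem hn α η k z)]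
  simp only [pairing_apply, Fintype.sum_sum_type, covA, covB, tensor, Sum.elim_inl, Sum.elim_inr,
    mul_zero, zero_mul, Finset.sum_const_zero, add_zero, zero_add]
  exact Finset.sum_congr rfl fun _ _ => Finset.sum_congr rfl fun _ _ => by ring

lemma pairing_AC_eq : pairing α η k z (covA x) (covC y) = (brAC α η k z).evalEval x y := by
  rw [sum_deg_odd (brAC_mul α η k z) (brAC_mem hn α η k z)]
  simp only [pairing_apply, Fintype.sum_sum_type, covA, covC, tensor, Sum.elim_inl, Sum.elim_inr,
    mul_zero, zero_mul, Finset.sum_const_zero, add_zero, zero_add]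
  exact Finset.sum_congr rfl fun _ _ => Finset.sum_congr rfl fun _ _ => by ring

lemma pairing_BC_eq : pairing α η k z (covB x) (covC y) = (brBC α η k z).evalEval x y := by
  rw [sum_odd_odd (brBC_mul α η k z) (brBC_mem hn α η k z)]
  simp only [pairing_apply, Fintype.sum_sum_type, covB, covC, tensor, Sum.elim_inl, Sum.elim_inr,
    mul_zero, zero_mul, Finset.sum_const_zero, add_zero, zero_add]
  exact Finset.sum_congr rfl fun _ _ => Finset.sum_congr rfl fun _ _ => by ring

lemma pairing_CC_eq : pairing α η k z (covC x) (covC y) = (brCC α η k z).evalEval x y := by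
  rw [sum_odd_odd rfl (brCC_mem hn α η k z)]
  simp only [pairing_apply, Fintype.sum_sum_type, covC, tensor, Sum.elim_inl, Sum.elim_inr,
    mul_zero, zero_mul, Finset.sum_const_zero, zero_add]
  exact Finset.sum_congr rfl fun _ _ => Finset.sum_congr rfl fun _ _ => by ring

lemma pairing_AA : pairing α η k z (covA x) (covA y) * (x + y)
    = η * (y ^ (2 * (k : ℕ)) * (polyB z).eval x * (polyC z).eval y
      - x ^ (2 * (k : ℕ)) * (polyB z).eval y * (polyC z).eval x) := by
  have h := congrArg (evalEval x y) (brAA_mul η k z)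
  simp only [evalEval_mul, evalEval_add, evalEval_sub, evalEval_pow, evalEval_C, evalEval_X,
    evalEval_map_C, eval_X, eval_C] at h
  rw [pairing_AA_eq hn, h]

lemma pairing_AB : pairing α η k z (covA x) (covB y) * (x ^ 2 - y ^ 2) = η * (
      (x ^ (2 * (k : ℕ)) * (polyA α z).eval x * (polyB z).eval y
        - y ^ (2 * (k : ℕ)) * (polyA α z).eval y * (polyB z).eval x) * (x + y)
      + (x ^ (2 * (k : ℕ)) * (polyA α z).eval x * (polyB z).eval y
        + y ^ (2 * (k : ℕ)) * (polyA α z).eval (-y) * (polyB z).eval x) * (x - y)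
      - 2 * ((rho α z k).eval x * (polyB z).eval x * (polyB z).eval y) * (x ^ 2 - y ^ 2)) := by
  have h := congrArg (evalEval x y) (brAB_mul_raw α η k z)
  rw [two_eq_CC] at h
  simp only [evalEval_mul, evalEval_add, evalEval_sub, evalEval_pow, evalEval_C, evalEval_X,
    evalEval_map_C, eval_X, eval_C, eval_comp, eval_neg] at h
  rw [pairing_AB_eq hn, h]

lemma pairing_AC : pairing α η k z (covA x) (covC y) * (x ^ 2 - y ^ 2) = η * (
      -(y ^ (2 * (k : ℕ)) * (polyA α z).eval x * (polyC z).eval y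
        - x ^ (2 * (k : ℕ)) * (polyA α z).eval y * (polyC z).eval x) * (x + y)
      - 2 * ((k : ℕ) : ℂ) * (x * (polyA α z).eval x * (polyC z).eval y) * (x ^ 2 - y ^ 2)
      - (y ^ (2 * (k : ℕ)) * (polyA α z).eval x * (polyC z).eval y
        + x ^ (2 * (k : ℕ)) * (polyA α z).eval (-y) * (polyC z).eval x) * (x - y)
      + 2 * ((rho α z k).eval x * (polyB z).eval x * (polyC z).eval y) * (x ^ 2 - y ^ 2)) := by
  have h := congrArg (evalEval x y) (brAC_mul_raw α η k z)
  rw [two_eq_CC] at h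
  simp only [evalEval_mul, evalEval_add, evalEval_sub, evalEval_pow, evalEval_C, evalEval_X,
    evalEval_map_C, eval_X, eval_C, eval_comp, eval_neg, evalEval_neg, evalEval_natCast] at h
  rw [pairing_AC_eq hn, h]

lemma pairing_BC : pairing α η k z (covB x) (covC y) * (x ^ 2 - y ^ 2) = η * (
      x ^ (2 * (k : ℕ)) * ((polyA α z).eval (-x) * (polyA α z).eval y
        - (polyA α z).eval x * (polyA α z).eval (-y)) * (x + y)
      + x ^ (2 * (k : ℕ)) * ((polyA α z).eval x * (polyA α z).eval y
        - (polyA α z).eval (-x) * (polyA α z).eval (-y)) * (x - y)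
      + 2 * (((rho α z k).eval y * (polyA α z).eval (-y)
        - (rho α z k).eval (-y) * (polyA α z).eval y) * (polyB z).eval x)
          * (x ^ 2 - y ^ 2)) := by
  have h := congrArg (evalEval x y) (brBC_mul_raw α η k z)
  rw [two_eq_CC] at h
  simp only [evalEval_mul, evalEval_add, evalEval_sub, evalEval_pow, evalEval_C, evalEval_X,
    evalEval_map_C, eval_X, eval_C, eval_comp, eval_neg] at h
  rw [pairing_BC_eq hn, h]

lemma pairing_CC : pairing α η k z (covC x) (covC y) = η * (
      2 * (((rho α z k).eval (-y) * (polyA α z).eval y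
        - (rho α z k).eval y * (polyA α z).eval (-y)) * (polyC z).eval x)
      - 2 * (((rho α z k).eval (-x) * (polyA α z).eval x
        - (rho α z k).eval x * (polyA α z).eval (-x)) * (polyC z).eval y)) := by
  have h := congrArg (evalEval x y) (brCC_raw α η k z)
  rw [two_eq_CC] at h
  simp only [evalEval_mul, evalEval_sub, evalEval_C,
    evalEval_map_C, eval_X, eval_C, eval_comp, eval_neg] at h
  rw [pairing_CC_eq hn, h]

/-! ### The coefficients of `det T(λ)` are Casimir functions -/

/-- By the Leibniz rule this is a combination of four known pairings. With denominators cleared it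
cancels identically, the ρ_k terms included, using only that B and C are odd; ρ_k enters as an
unknown. -/
lemma pairing_det_A : pairing α η k z (covDet α z x) (covA y) * (x ^ 2 - y ^ 2) = 0 := by
  have h1 := pairing_AA hn α η k z x y
  have h2 := pairing_AA hn α η k z (-x) y
  have h3 := pairing_AB hn α η k z y x
  have h4 := pairing_AC hn α η k z y x
  rw [polyB_eval_neg, polyC_eval_neg] at h2
  have hk : (k : ℕ) = 0 ∨ (k : ℕ) = 1 := by fin_cases k <;> simp
  simp only [covDet, map_sub, map_add, map_smul, LinearMap.sub_apply, LinearMap.add_apply,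
    LinearMap.smul_apply, smul_eq_mul]
  rw [pairing_antisymm α η k z (covB x), pairing_antisymm α η k z (covC x)]
  rcases hk with hk | hk <;> simp only [hk, Nat.cast_zero, Nat.cast_one, mul_zero, mul_one,
    pow_zero] at h1 h2 h3 h4 <;>
  linear_combination (polyA α z).eval (-x) * (x - y) * h1
    - (polyA α z).eval x * (x + y) * h2 - (polyC z).eval x * h3 - (polyB z).eval x * h4

lemma pairing_det_B : pairing α η k z (covDet α z x) (covB y) * (x ^ 2 - y ^ 2) = 0 := by
  have h1 := pairing_AB hn α η k z x y
  have h2 := pairing_AB hn α η k z (-x) y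
  have h4 := pairing_BC hn α η k z y x
  rw [polyB_eval_neg, neg_sq] at h2
  have hk : (k : ℕ) = 0 ∨ (k : ℕ) = 1 := by fin_cases k <;> simp
  simp only [covDet, map_sub, map_add, map_smul, LinearMap.sub_apply, LinearMap.add_apply,
    LinearMap.smul_apply, smul_eq_mul, pairing_BB]
  rw [pairing_antisymm α η k z (covC x)]
  rcases hk with hk | hk <;> simp only [hk, mul_zero, mul_one, pow_zero] at h1 h2 h4 <;>
  linear_combination (polyA α z).eval (-x) * h1
    + (polyA α z).eval x * h2 - (polyB z).eval x * h4

lemma pairing_det_C : pairing α η k z (covDet α z x) (covC y) * (x ^ 2 - y ^ 2) = 0 := by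
  have h1 := pairing_AC hn α η k z x y
  have h2 := pairing_AC hn α η k z (-x) y
  have h3 := pairing_BC hn α η k z x y
  have h4 := pairing_CC hn α η k z x y
  rw [polyB_eval_neg, polyC_eval_neg, neg_sq] at h2
  have hk : (k : ℕ) = 0 ∨ (k : ℕ) = 1 := by fin_cases k <;> simp
  simp only [covDet, map_sub, map_add, map_smul, LinearMap.sub_apply, LinearMap.add_apply,
    LinearMap.smul_apply, smul_eq_mul]
  rcases hk with hk | hk <;> simp only [hk, Nat.cast_zero, Nat.cast_one, mul_zero, mul_one,
    pow_zero] at h1 h2 h3 h4 <;>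
  linear_combination (polyA α z).eval (-x) * h1
    + (polyA α z).eval x * h2 - (polyC z).eval x * h3 - (polyB z).eval x * (x ^ 2 - y ^ 2) * h4

end values

/-! ### Linear forms are determined by their values on generic dA(y), dB(y), dC(y) -/

lemma eq_zero_of_forall_sum_pow {ι : Type*} [Fintype ι] (c : ι → ℂ) (f : ι → ℕ)
    (hf : Function.Injective f) (S : Set ℂ) (hS : S.Finite)
    (h : ∀ y ∉ S, ∑ a, c a * y ^ f a = 0) (a : ι) : c a = 0 := by
  classical
  set p : ℂ[X] := ∑ a, C (c a) * X ^ f a with hp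
  have h0 : p = 0 := by
    refine eq_zero_of_infinite_isRoot p (hS.infinite_compl.mono fun y hy => ?_)
    simpa [hp, IsRoot, eval_finsetSum] using h y hy
  have := congrArg (fun q => q.coeff (f a)) h0
  simpa [hp, finsetSum_coeff, hf.eq_iff] using this

lemma linearMap_eq_sum (L : (Gen n → ℂ) →ₗ[ℂ] ℂ) (u : Gen n → ℂ) :
    L u = ∑ a, L (Pi.single a 1) * u a := by
  rw [LinearMap.pi_apply_eq_sum_univ]
  refine Finset.sum_congr rfl fun a _ => ?_
  rw [smul_eq_mul, mul_comm]
  congr 2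
  ext b
  simp [Pi.single_apply, eq_comm]

lemma linearMap_covA (L : (Gen n → ℂ) →ₗ[ℂ] ℂ) (x : ℂ) :
    L (covA x) = ∑ i : Fin (2 * n + 1), L (Pi.single (genA i) 1) * x ^ (i : ℕ) := by
  rw [linearMap_eq_sum]
  simp [Fintype.sum_sum_type, covA]

lemma linearMap_covB (L : (Gen n → ℂ) →ₗ[ℂ] ℂ) (x : ℂ) :
    L (covB x) = ∑ i : Fin n, L (Pi.single (genB i) 1) * x ^ (2 * (i : ℕ) + 1) := by
  rw [linearMap_eq_sum]
  simp [Fintype.sum_sum_type, covB]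

lemma linearMap_covC (L : (Gen n → ℂ) →ₗ[ℂ] ℂ) (x : ℂ) :
    L (covC x) = ∑ i : Fin n, L (Pi.single (genC i) 1) * x ^ (2 * (i : ℕ) + 1) := by
  rw [linearMap_eq_sum]
  simp [Fintype.sum_sum_type, covC]

/-- On each of the three families L is a polynomial in y whose coefficients are its values on basis
covectors; a polynomial vanishing off a finite set is zero. -/
lemma linearMap_eq_zero (L : (Gen n → ℂ) →ₗ[ℂ] ℂ) (S : Set ℂ) (hS : S.Finite)
    (hA : ∀ y ∉ S, L (covA y) = 0) (hB : ∀ y ∉ S, L (covB y) = 0)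
    (hC : ∀ y ∉ S, L (covC y) = 0) : L = 0 := by
  simp only [linearMap_covA, linearMap_covB, linearMap_covC] at hA hB hC
  refine LinearMap.ext fun u => ?_
  rw [linearMap_eq_sum L u, LinearMap.zero_apply]
  refine Finset.sum_eq_zero fun a _ => ?_
  rcases a with a | a | a
  · rw [eq_zero_of_forall_sum_pow _ _ Fin.val_injective S hS hA a, zero_mul]
  · rw [eq_zero_of_forall_sum_pow _ _ injective_odd S hS hB a, zero_mul]
  · rw [eq_zero_of_forall_sum_pow _ _ injective_odd S hS hC a, zero_mul]

/-- The identities with the factor x² - y² say nothing at y = ±x, but the remaining y suffice to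
detect a linear form. -/
lemma pairing_det (hn : 1 ≤ n) (α η : ℂ) (k : Fin 2) (z : Phase n) (x : ℂ) :
    pairing α η k z (covDet α z x) = 0 := by
  have key : ∀ {c y : ℂ}, y ∉ ({x, -x} : Set ℂ) → c * (x ^ 2 - y ^ 2) = 0 → c = 0 := by
    intro c y hy h
    refine (mul_eq_zero.1 h).resolve_right fun h' => hy ?_
    rcases sq_eq_sq_iff_eq_or_eq_neg.1 (sub_eq_zero.1 h') with h | h
    · exact Or.inl h.symm
    · exact Or.inr (by rw [h, neg_neg]; rfl)
  exact linearMap_eq_zero _ {x, -x} (Set.toFinite _)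
    (fun y hy => key hy (pairing_det_A hn α η k z x y))
    (fun y hy => key hy (pairing_det_B hn α η k z x y))
    (fun y hy => key hy (pairing_det_C hn α η k z x y))

/-! ### Brackets at the zeros of `B(λ)` -/

lemma pairing_AA_zero (hn : 1 ≤ n) (α η : ℂ) (k : Fin 2) (z : Phase n) {x y : ℂ}
    (hx : (polyB z).eval x = 0) (hy : (polyB z).eval y = 0) (hxy : x + y ≠ 0) :
    pairing α η k z (covA x) (covA y) = 0 := by
  have h := pairing_AA hn α η k z x y
  rw [hx, hy] at h
  refine (mul_eq_zero.1 (h.trans (by ring))).resolve_right hxy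

lemma pairing_AB_zero (hn : 1 ≤ n) (α η : ℂ) (k : Fin 2) (z : Phase n) {x y : ℂ}
    (hx : (polyB z).eval x = 0) (hy : (polyB z).eval y = 0) (hxy : x ^ 2 ≠ y ^ 2) :
    pairing α η k z (covA x) (covB y) = 0 := by
  have h := pairing_AB hn α η k z x y
  rw [hx, hy] at h
  refine (mul_eq_zero.1 (h.trans (by ring))).resolve_right (sub_ne_zero.2 hxy)

/-- The bracket formula is 0 = 0 at x = r, so the value is found by l'Hôpital's rule: the pairing is
polynomial in x, and its product with x² - r² is differentiated at r. -/
lemma pairing_AB_diag (hn : 1 ≤ n) (α η : ℂ) (z : Phase n) {r : ℂ} (hr0 : r ≠ 0)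
    (hr : (polyB z).eval r = 0) : pairing α η 0 z (covA r) (covB r)
      = -η * (polyA α z).eval r * (polyB z).derivative.eval r := by
  set p : ℂ[X] := ∑ i : Fin (2 * n + 1), C (pairing α η 0 z (Pi.single (genA i) 1) (covB r))
    * X ^ (i : ℕ) with hp
  have hpe : ∀ x, p.eval x = pairing α η 0 z (covA x) (covB r) := by
    intro x
    have := linearMap_covA (LinearMap.flip (pairing α η 0 z) (covB r)) x
    rw [LinearMap.flip_apply] at this
    rw [hp, this, eval_finsetSum]
    simp
  have hpoly : p * (X ^ 2 - C (r ^ 2)) = C η * polyB z * (C ((polyA α z).eval (-r)) * (X - C r)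
      - C ((polyA α z).eval r) * (X + C r)) := by
    refine Polynomial.funext fun x => ?_
    have h := pairing_AB hn α η 0 z x r
    rw [hr, rho_zero] at h
    simp only [eval_mul, eval_sub, eval_add, eval_pow, eval_X, eval_C, hpe]
    rw [h]
    simp
    ring
  have hd := congrArg (fun q => (derivative q).eval r) hpoly
  simp [hr, hpe, derivative_pow] at hd
  have h2 : (2 * r) ≠ 0 := by simpa using hr0
  apply mul_right_cancel₀ h2
  linear_combination hd

/-! ### Polynomial families over the phase space -/

/-- The coefficients of `F z` are polynomial functions of `z`. -/
def PolyFam (F : Phase n → ℂ[X]) : Prop :=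
  ∃ G : (MvPolynomial (Gen n) ℂ)[X], ∀ z, F z = G.map (MvPolynomial.eval z)

/-- The coefficients of `F z` are polynomial functions of `z`, for polynomials in two variables. -/
def PolyFam₂ (F : Phase n → ℂ[X][X]) : Prop :=
  ∃ G : (MvPolynomial (Gen n) ℂ)[X][X], ∀ z, F z = G.map (mapRingHom (MvPolynomial.eval z))

namespace PolyFam

variable {F G : Phase n → ℂ[X]}

lemma const (p : ℂ[X]) : PolyFam fun _ : Phase n => p := by
  refine ⟨p.map MvPolynomial.C, fun z => ?_⟩
  have : (MvPolynomial.eval z).comp MvPolynomial.C = RingHom.id ℂ := by ext x; simp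
  rw [Polynomial.map_map, this, Polynomial.map_id]

lemma coord (a : Gen n) : PolyFam fun z : Phase n => C (z a) :=
  ⟨C (MvPolynomial.X a), fun z => by simp⟩

lemma add (hF : PolyFam F) (hG : PolyFam G) : PolyFam fun z => F z + G z := by
  obtain ⟨f, hf⟩ := hF
  obtain ⟨g, hg⟩ := hG
  exact ⟨f + g, fun z => by simp [hf, hg]⟩

lemma sub (hF : PolyFam F) (hG : PolyFam G) : PolyFam fun z => F z - G z := by
  obtain ⟨f, hf⟩ := hF
  obtain ⟨g, hg⟩ := hG
  exact ⟨f - g, fun z => by simp [hf, hg]⟩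

lemma mul (hF : PolyFam F) (hG : PolyFam G) : PolyFam fun z => F z * G z := by
  obtain ⟨f, hf⟩ := hF
  obtain ⟨g, hg⟩ := hG
  exact ⟨f * g, fun z => by simp [hf, hg]⟩

lemma sum {ι : Type*} (s : Finset ι) {F : ι → Phase n → ℂ[X]} (hF : ∀ i, PolyFam (F i)) :
    PolyFam fun z => ∑ i ∈ s, F i z := by
  choose f hf using hF
  exact ⟨∑ i ∈ s, f i, fun z => by simp [hf, Polynomial.map_sum]⟩

lemma comp_neg (hF : PolyFam F) : PolyFam fun z => (F z).comp (-X) := by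
  obtain ⟨f, hf⟩ := hF
  exact ⟨f.comp (-X), fun z => by simp [hf, Polynomial.map_comp]⟩

lemma derivative (hF : PolyFam F) : PolyFam fun z => Polynomial.derivative (F z) := by
  obtain ⟨f, hf⟩ := hF
  exact ⟨Polynomial.derivative f, fun z => by simp [hf, Polynomial.derivative_map]⟩

lemma coeff (hF : PolyFam F) (l : ℕ) :
    ∃ p : MvPolynomial (Gen n) ℂ, ∀ z, (F z).coeff l = MvPolynomial.eval z p := by
  obtain ⟨f, hf⟩ := hF
  exact ⟨f.coeff l, fun z => by simp [hf]⟩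

/-- The bound is uniform in z, so that a value F z (x) is one fixed finite sum of coefficients,
which can be differentiated term by term. -/
lemma exists_natDegree_lt (hF : PolyFam F) : ∃ L, ∀ z, (F z).natDegree < L := by
  obtain ⟨f, hf⟩ := hF
  exact ⟨f.natDegree + 1, fun z => by rw [hf, Nat.lt_succ_iff]; exact natDegree_map_le⟩

end PolyFam

namespace PolyFam₂

variable {F G : Phase n → ℂ[X][X]}

lemma const (p : ℂ[X][X]) : PolyFam₂ fun _ : Phase n => p := by
  refine ⟨p.map (mapRingHom MvPolynomial.C), fun z => ?_⟩
  have : (mapRingHom (MvPolynomial.eval z)).comp (mapRingHom MvPolynomial.C)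
      = RingHom.id ℂ[X] := by ext x <;> simp
  rw [Polynomial.map_map, this, Polynomial.map_id]

lemma add (hF : PolyFam₂ F) (hG : PolyFam₂ G) : PolyFam₂ fun z => F z + G z := by
  obtain ⟨f, hf⟩ := hF
  obtain ⟨g, hg⟩ := hG
  exact ⟨f + g, fun z => by simp [hf, hg]⟩

lemma sub (hF : PolyFam₂ F) (hG : PolyFam₂ G) : PolyFam₂ fun z => F z - G z := by
  obtain ⟨f, hf⟩ := hF
  obtain ⟨g, hg⟩ := hG
  exact ⟨f - g, fun z => by simp [hf, hg]⟩

lemma neg (hF : PolyFam₂ F) : PolyFam₂ fun z => -F z := by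
  obtain ⟨f, hf⟩ := hF
  exact ⟨-f, fun z => by simp [hf]⟩

lemma mul (hF : PolyFam₂ F) (hG : PolyFam₂ G) : PolyFam₂ fun z => F z * G z := by
  obtain ⟨f, hf⟩ := hF
  obtain ⟨g, hg⟩ := hG
  exact ⟨f * g, fun z => by simp [hf, hg]⟩

lemma smul (η : ℂ) (hF : PolyFam₂ F) : PolyFam₂ fun z => η • F z := by
  simp only [smul_eq_CC]
  exact (const _).mul hF

lemma divSub (hF : PolyFam₂ F) : PolyFam₂ fun z => divSub (F z) := by
  obtain ⟨f, hf⟩ := hF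
  refine ⟨-(f /ₘ (X - C X)), fun z => ?_⟩
  beta_reduce
  rw [ReflectionAlgebra.divSub, hf, Polynomial.map_neg, map_divByMonic _ (monic_X_sub_C _)]
  simp

lemma divAdd (hF : PolyFam₂ F) : PolyFam₂ fun z => divAdd (F z) := by
  obtain ⟨f, hf⟩ := hF
  refine ⟨f /ₘ (X - C (-X)), fun z => ?_⟩
  beta_reduce
  rw [ReflectionAlgebra.divAdd, hf, map_divByMonic _ (monic_X_sub_C _)]
  simp

lemma ev_lam {F : Phase n → ℂ[X]} (hF : PolyFam F) : PolyFam₂ fun z => ev (F z) lam := by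
  obtain ⟨f, hf⟩ := hF
  exact ⟨C f, fun z => by simp [ReflectionAlgebra.ev_lam, hf]⟩

lemma ev_mu {F : Phase n → ℂ[X]} (hF : PolyFam F) : PolyFam₂ fun z => ev (F z) mu := by
  obtain ⟨f, hf⟩ := hF
  refine ⟨f.map C, fun z => ?_⟩
  beta_reduce
  rw [ReflectionAlgebra.ev_mu, hf, Polynomial.map_map, Polynomial.map_map]
  congr 1
  ext x <;> simp

lemma ev_neg_lam {F : Phase n → ℂ[X]} (hF : PolyFam F) : PolyFam₂ fun z => ev (F z) (-lam) := by
  simp only [ev_neg]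
  exact ev_lam hF.comp_neg

lemma ev_neg_mu {F : Phase n → ℂ[X]} (hF : PolyFam F) : PolyFam₂ fun z => ev (F z) (-mu) := by
  simp only [ev_neg]
  exact ev_mu hF.comp_neg

lemma coeff₂ (hF : PolyFam₂ F) (i j : ℕ) :
    ∃ p : MvPolynomial (Gen n) ℂ, ∀ z, coeff₂ (F z) i j = MvPolynomial.eval z p := by
  obtain ⟨f, hf⟩ := hF
  exact ⟨(f.coeff j).coeff i, fun z => by simp [ReflectionAlgebra.coeff₂, hf]⟩

end PolyFam₂

lemma polyFam_A (α : ℂ) : PolyFam fun z : Phase n => polyA α z :=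
  (PolyFam.const _).add (PolyFam.sum _ fun _ => (PolyFam.coord _).mul (PolyFam.const _))

lemma polyFam_B : PolyFam fun z : Phase n => polyB z :=
  (PolyFam.const _).add (PolyFam.sum _ fun _ => (PolyFam.coord _).mul (PolyFam.const _))

lemma polyFam_C : PolyFam fun z : Phase n => polyC z :=
  PolyFam.sum _ fun _ => (PolyFam.coord _).mul (PolyFam.const _)

lemma polyFam_rho (α : ℂ) (k : Fin 2) : PolyFam fun z : Phase n => rho α z k := by
  fin_cases k
  · exact PolyFam.const 0
  · exact (PolyFam.const (C α * X)).add (PolyFam.coord _)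

lemma polyFam_det (α : ℂ) : PolyFam fun z : Phase n => (matT α z).det := by
  simp only [matT, Matrix.det_fin_two_of]
  exact ((polyFam_A α).mul (polyFam_A α).comp_neg).sub (polyFam_B.mul polyFam_C)

/-! ### The structure functions are polynomial, hence continuous -/

section brackets

variable (α η : ℂ) (k : Fin 2)

lemma polyFam_brAA : PolyFam₂ fun z : Phase n => brAA η k z :=
  (PolyFam₂.divAdd
    ((((PolyFam₂.const _).mul (.ev_lam polyFam_B)).mul (.ev_mu polyFam_C)).sub
      (((PolyFam₂.const _).mul (.ev_mu polyFam_B)).mul (.ev_lam polyFam_C)))).smul η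

lemma polyFam_brCC : PolyFam₂ fun z : Phase n => brCC α η k z :=
  (PolyFam₂.smul _ ((((PolyFam₂.ev_neg_mu (polyFam_rho α k)).mul (.ev_mu (polyFam_A α))).sub
      ((PolyFam₂.ev_mu (polyFam_rho α k)).mul (.ev_neg_mu (polyFam_A α)))).mul
        (.ev_lam polyFam_C))).sub
    (PolyFam₂.smul _ ((((PolyFam₂.ev_neg_lam (polyFam_rho α k)).mul (.ev_lam (polyFam_A α))).sub
      ((PolyFam₂.ev_lam (polyFam_rho α k)).mul (.ev_neg_lam (polyFam_A α)))).mul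
        (.ev_mu polyFam_C)))

lemma polyFam_brAB : PolyFam₂ fun z : Phase n => brAB α η k z :=
  ((PolyFam₂.smul _ (PolyFam₂.divSub
    ((((PolyFam₂.const _).mul (.ev_lam (polyFam_A α))).mul (.ev_mu polyFam_B)).sub
      (((PolyFam₂.const _).mul (.ev_mu (polyFam_A α))).mul (.ev_lam polyFam_B))))).add
  (PolyFam₂.smul _ (PolyFam₂.divAdd
    ((((PolyFam₂.const _).mul (.ev_lam (polyFam_A α))).mul (.ev_mu polyFam_B)).add
      (((PolyFam₂.const _).mul (.ev_neg_mu (polyFam_A α))).mul (.ev_lam polyFam_B)))))).sub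
  (PolyFam₂.smul _ (((PolyFam₂.ev_lam (polyFam_rho α k)).mul (.ev_lam polyFam_B)).mul
    (.ev_mu polyFam_B)))

lemma polyFam_brAC : PolyFam₂ fun z : Phase n => brAC α η k z :=
  ((((PolyFam₂.smul _ (PolyFam₂.divSub
    ((((PolyFam₂.const _).mul (.ev_lam (polyFam_A α))).mul (.ev_mu polyFam_C)).sub
      (((PolyFam₂.const _).mul (.ev_mu (polyFam_A α))).mul (.ev_lam polyFam_C))))).neg).sub
  (PolyFam₂.smul _ (((PolyFam₂.const _).mul (.ev_lam (polyFam_A α))).mul (.ev_mu polyFam_C)))).sub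
  (PolyFam₂.smul _ (PolyFam₂.divAdd
    ((((PolyFam₂.const _).mul (.ev_lam (polyFam_A α))).mul (.ev_mu polyFam_C)).add
      (((PolyFam₂.const _).mul (.ev_neg_mu (polyFam_A α))).mul (.ev_lam polyFam_C)))))).add
  (PolyFam₂.smul _ (((PolyFam₂.ev_lam (polyFam_rho α k)).mul (.ev_lam polyFam_B)).mul
    (.ev_mu polyFam_C)))

lemma polyFam_brBC : PolyFam₂ fun z : Phase n => brBC α η k z :=
  ((PolyFam₂.smul _ ((PolyFam₂.const _).mul (PolyFam₂.divSub
    (((PolyFam₂.ev_neg_lam (polyFam_A α)).mul (.ev_mu (polyFam_A α))).sub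
      ((PolyFam₂.ev_lam (polyFam_A α)).mul (.ev_neg_mu (polyFam_A α))))))).add
  (PolyFam₂.smul _ ((PolyFam₂.const _).mul (PolyFam₂.divAdd
    (((PolyFam₂.ev_lam (polyFam_A α)).mul (.ev_mu (polyFam_A α))).sub
      ((PolyFam₂.ev_neg_lam (polyFam_A α)).mul (.ev_neg_mu (polyFam_A α)))))))).add
  (PolyFam₂.smul _ ((((PolyFam₂.ev_mu (polyFam_rho α k)).mul (.ev_neg_mu (polyFam_A α))).sub
    ((PolyFam₂.ev_neg_mu (polyFam_rho α k)).mul (.ev_mu (polyFam_A α)))).mul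
      (.ev_lam polyFam_B)))

lemma exists_tensor_eq (a b : Gen n) :
    ∃ p : MvPolynomial (Gen n) ℂ, ∀ z, tensor α η k z a b = MvPolynomial.eval z p := by
  have neg : ∀ {f : Phase n → ℂ}, (∃ p : MvPolynomial (Gen n) ℂ, ∀ z, f z = MvPolynomial.eval z p) →
      ∃ p : MvPolynomial (Gen n) ℂ, ∀ z, -f z = MvPolynomial.eval z p := by
    rintro f ⟨p, hp⟩
    exact ⟨-p, fun z => by simp [hp]⟩
  rcases a with i | i | i <;> rcases b with j | j | j
  · exact (polyFam_brAA η k).coeff₂ _ _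
  · exact (polyFam_brAB α η k).coeff₂ _ _
  · exact (polyFam_brAC α η k).coeff₂ _ _
  · exact neg ((polyFam_brAB α η k).coeff₂ _ _)
  · exact ⟨0, fun z => by simp [tensor]⟩
  · exact (polyFam_brBC α η k).coeff₂ _ _
  · exact neg ((polyFam_brAC α η k).coeff₂ _ _)
  · exact neg ((polyFam_brBC α η k).coeff₂ _ _)
  · exact (polyFam_brCC α η k).coeff₂ _ _

lemma continuous_tensor (a b : Gen n) : Continuous fun z => tensor α η k z a b := by
  obtain ⟨p, hp⟩ := exists_tensor_eq α η k a b
  simp only [hp]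
  exact MvPolynomial.continuous_eval p

end brackets

lemma analyticOnNhd_eval (p : MvPolynomial (Gen n) ℂ) (s : Set (Phase n)) :
    AnalyticOnNhd ℂ (fun z => MvPolynomial.eval z p) s :=
  AnalyticOnNhd.eval_mvPolynomial p |>.mono (Set.subset_univ _)

lemma PolyFam.analyticOnNhd_coeff {F : Phase n → ℂ[X]} (hF : PolyFam F) (l : ℕ)
    (s : Set (Phase n)) : AnalyticOnNhd ℂ (fun z => (F z).coeff l) s := by
  obtain ⟨p, hp⟩ := hF.coeff l
  simp only [hp]
  exact analyticOnNhd_eval p s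

/-- A nonzero polynomial does not vanish identically on a nonempty open set. -/
lemma exists_eval_ne_zero {p : MvPolynomial (Gen n) ℂ} (hp : p ≠ 0) {V : Set (Phase n)}
    (hV : IsOpen V) (hne : V.Nonempty) : ∃ z ∈ V, MvPolynomial.eval z p ≠ 0 := by
  obtain ⟨z, hz⟩ := hne
  obtain ⟨ε, hε, hsub⟩ := Metric.isOpen_iff.1 hV z hz
  by_contra! hcon
  refine hp (MvPolynomial.funext_set (fun a => Metric.ball (z a) ε) (fun a => ?_) fun x hx => ?_)
  · exact infinite_of_mem_nhds (z a) (Metric.ball_mem_nhds _ hε)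
  · rw [map_zero]
    refine hcon x (hsub ?_)
    rw [Metric.mem_ball, dist_pi_lt_iff hε]
    exact fun a => hx a (Set.mem_univ a)

/-! ### Differentials of functions on the phase space -/

/-- The components of a covector. -/
def comps : (Phase n →L[ℂ] ℂ) →ₗ[ℂ] (Gen n → ℂ) where
  toFun L a := L (Pi.single a 1)
  map_add' _ _ := rfl
  map_smul' _ _ := rfl

/-- The covector with given components. -/
def cov (u : Gen n → ℂ) : Phase n →L[ℂ] ℂ :=
  ∑ a, u a • (ContinuousLinearMap.proj a : Phase n →L[ℂ] ℂ)

lemma comps_cov (u : Gen n → ℂ) : comps (cov u) = u := by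
  ext a
  simp [comps, cov, Pi.single_apply, -Fintype.sum_sum_type]

/-- The bivector of the bracket `{·,·}_k`, as a bilinear form on the cotangent space. -/
def poisson (α η : ℂ) (k : Fin 2) (z : Phase n) : LinearMap.BilinForm ℂ (Phase n →L[ℂ] ℂ) :=
  (pairing α η k z).compl₁₂ comps comps

lemma poisson_apply (α η : ℂ) (k : Fin 2) (z : Phase n) (u v : Phase n →L[ℂ] ℂ) :
    poisson α η k z u v = pairing α η k z (comps u) (comps v) := rfl

lemma bracket_eq (α η : ℂ) (k : Fin 2) (f g : Phase n → ℂ) (z : Phase n) :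
    bracket α η k f g z = poisson α η k z (fderiv ℂ f z) (fderiv ℂ g z) := by
  rw [poisson_apply, pairing_apply, bracket]
  exact Finset.sum_congr rfl fun _ _ => Finset.sum_congr rfl fun _ _ => by
    simp only [partialDeriv, comps, LinearMap.coe_mk, AddHom.coe_mk]
    ring

lemma poisson_antisymm (α η : ℂ) (k : Fin 2) (z : Phase n) (u v : Phase n →L[ℂ] ℂ) :
    poisson α η k z u v = -poisson α η k z v u :=
  pairing_antisymm α η k z _ _

/-- The differential of `A(x)`. -/
def dA (x : ℂ) : Phase n →L[ℂ] ℂ := cov (covA x)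

/-- The differential of `B(x)`. -/
def dB (x : ℂ) : Phase n →L[ℂ] ℂ := cov (covB x)

/-- The differential of `C(x)`. -/
def dC (x : ℂ) : Phase n →L[ℂ] ℂ := cov (covC x)

lemma polyA_eval (α : ℂ) (z : Phase n) (x : ℂ) :
    (polyA α z).eval x = α * x ^ (2 * n + 1) + dA x z := by
  simp [polyA, dA, cov, eval_finsetSum, Fintype.sum_sum_type, covA]
  exact Finset.sum_congr rfl fun _ _ => mul_comm _ _

lemma hasFDerivAt_A (α : ℂ) (z : Phase n) (x : ℂ) :
    HasFDerivAt (fun z => (polyA α z).eval x) (dA x : Phase n →L[ℂ] ℂ) z := by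
  simp only [polyA_eval]
  exact (dA x).hasFDerivAt.const_add _

lemma polyB_eval (z : Phase n) (x : ℂ) :
    (polyB z).eval x = x ^ (2 * n + 1) + dB x z := by
  simp [polyB, dB, cov, eval_finsetSum, Fintype.sum_sum_type, covB]
  exact Finset.sum_congr rfl fun _ _ => mul_comm _ _

lemma hasFDerivAt_B (z : Phase n) (x : ℂ) :
    HasFDerivAt (fun z => (polyB z).eval x) (dB x : Phase n →L[ℂ] ℂ) z := by
  simp only [polyB_eval]
  exact (dB x).hasFDerivAt.const_add _

lemma hasFDerivAt_C (z : Phase n) (x : ℂ) :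
    HasFDerivAt (fun z => (polyC z).eval x) (dC x : Phase n →L[ℂ] ℂ) z := by
  have h : (fun z : Phase n => (polyC z).eval x) = fun z => (dC x : Phase n →L[ℂ] ℂ) z := by
    ext z
    simp [polyC, dC, cov, eval_finsetSum, Fintype.sum_sum_type, covC]
    exact Finset.sum_congr rfl fun _ _ => mul_comm _ _
  rw [h]
  exact (dC x).hasFDerivAt

/-- The differential of `det T(x)`. -/
def dDet (α : ℂ) (z : Phase n) (x : ℂ) : Phase n →L[ℂ] ℂ :=
  (polyA α z).eval (-x) • dA x + (polyA α z).eval x • dA (-x)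
    - (polyC z).eval x • dB x - (polyB z).eval x • dC x

lemma comps_dDet (α : ℂ) (z : Phase n) (x : ℂ) : comps (dDet α z x) = covDet α z x := by
  simp [dDet, covDet, dA, dB, dC, comps_cov]

lemma hasFDerivAt_det (α : ℂ) (z : Phase n) (x : ℂ) :
    HasFDerivAt (fun z => (matT α z).det.eval x) (dDet α z x) z := by
  have h : (fun z : Phase n => (matT α z).det.eval x) = fun z =>
      (polyA α z).eval x * (polyA α z).eval (-x) - (polyB z).eval x * (polyC z).eval x := by
    ext z
    simp [matT, Matrix.det_fin_two_of, eval_comp]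
  rw [h]
  refine (((hasFDerivAt_A α z x).mul (hasFDerivAt_A α z (-x))).sub
    ((hasFDerivAt_B z x).mul (hasFDerivAt_C z x))).congr_fderiv ?_
  rw [dDet]
  abel

/-- Differentiating a family of polynomials coefficientwise. -/
lemma sum_fderiv_coeff {F : Phase n → ℂ[X]} {L : ℕ} (hL : ∀ z, (F z).natDegree < L) {z : Phase n}
    (hd : ∀ l, DifferentiableAt ℂ (fun z => (F z).coeff l) z) {x : ℂ} {D : Phase n →L[ℂ] ℂ}
    (hD : HasFDerivAt (fun z => (F z).eval x) D z) :
    ∑ l ∈ Finset.range L, x ^ l • fderiv ℂ (fun z => (F z).coeff l) z = D := by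
  refine HasFDerivAt.unique ?_ hD
  have h : (fun z => (F z).eval x)
      = fun z => ∑ l ∈ Finset.range L, x ^ l * (F z).coeff l := by
    ext z
    rw [eval_eq_sum_range' (hL z)]
    exact Finset.sum_congr rfl fun _ _ => mul_comm _ _
  rw [h]
  exact HasFDerivAt.fun_sum fun l _ => (hd l).hasFDerivAt.const_mul _

lemma PolyFam.differentiableAt_coeff {F : Phase n → ℂ[X]} (hF : PolyFam F) (l : ℕ) (z : Phase n) :
    DifferentiableAt ℂ (fun z => (F z).coeff l) z :=
  (hF.analyticOnNhd_coeff l Set.univ z (Set.mem_univ z)).differentiableAt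

/-- The differential of the value of det T at a fixed x is a combination of the differentials of its
coefficients. -/
lemma dDet_mem (α : ℂ) (z : Phase n) (x : ℂ) : dDet α z x ∈ casimirSpan α z := by
  obtain ⟨L, hL⟩ := (polyFam_det (n := n) α).exists_natDegree_lt
  rw [← sum_fderiv_coeff hL (fun l => (polyFam_det α).differentiableAt_coeff l z)
    (hasFDerivAt_det α z x)]
  exact Submodule.sum_mem _ fun l _ => Submodule.smul_mem _ _ (Submodule.subset_span ⟨l, rfl⟩)

/-- The coefficients of `det T(λ)` are Casimir functions of both brackets. -/
lemma poisson_casimir (hn : 1 ≤ n) (α η : ℂ) (k : Fin 2) (z : Phase n) {u : Phase n →L[ℂ] ℂ}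
    (hu : u ∈ casimirSpan α z) (v : Phase n →L[ℂ] ℂ) : poisson α η k z u v = 0 := by
  induction hu using Submodule.span_induction with
  | mem u hu =>
    obtain ⟨l, rfl⟩ := hu
    obtain ⟨L, hL⟩ := (polyFam_det (n := n) α).exists_natDegree_lt
    by_cases hl : l < L
    -- The pairing of d(det T(x)) with v is a polynomial in x vanishing for all x, so each of its
    -- coefficients vanishes.
    · refine eq_zero_of_forall_sum_pow (fun l : Fin L =>
        poisson α η k z (fderiv ℂ (detCoeff α l) z) v) (fun l => (l : ℕ)) Fin.val_injective ∅
        Set.finite_empty (fun x _ => ?_) ⟨l, hl⟩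
      have h := sum_fderiv_coeff hL (fun l => (polyFam_det α).differentiableAt_coeff l z)
        (hasFDerivAt_det α z x)
      have h' := congrArg (fun w => poisson α η k z w v) h
      have h0 : poisson α η k z (dDet α z x) v = 0 := by
        rw [poisson_apply, comps_dDet, pairing_det hn, LinearMap.zero_apply]
      simp only [h0, map_sum, map_smul, LinearMap.sum_apply, LinearMap.smul_apply,
        smul_eq_mul] at h'
      rw [Fin.sum_univ_eq_sum_range
        (fun l => poisson α η k z (fderiv ℂ (detCoeff α l) z) v * x ^ l) L, ← h']
      exact Finset.sum_congr rfl fun _ _ => mul_comm _ _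
    · have : detCoeff (n := n) α l = fun _ => 0 := by
        ext z
        exact coeff_eq_zero_of_natDegree_lt (by have := hL z; omega)
      beta_reduce
      rw [this]
      simp
  | zero => simp
  | add x y _ _ hx hy => rw [map_add, LinearMap.add_apply, hx, hy, add_zero]
  | smul a x _ hx => rw [map_smul, LinearMap.smul_apply, hx, smul_zero]

lemma poisson_casimir_right (hn : 1 ≤ n) (α η : ℂ) (k : Fin 2) (z : Phase n)
    {u : Phase n →L[ℂ] ℂ} (hu : u ∈ casimirSpan α z) (v : Phase n →L[ℂ] ℂ) :
    poisson α η k z v u = 0 := by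
  rw [poisson_antisymm, poisson_casimir hn α η k z hu, neg_zero]

/-! ### Linear algebra -/

/-- If `w` is triangular with respect to some covectors `b` for a form with kernel containing
`S`, then `w` is linearly independent modulo `S`. -/
lemma linearIndependent_mkQ {V ι : Type*} [AddCommGroup V] [Module ℂ V] [Fintype ι]
    (S : Submodule ℂ V) (P : LinearMap.BilinForm ℂ V) (hP : ∀ u ∈ S, ∀ v, P u v = 0)
    (w b : ι → V) (hd : ∀ i, P (w i) (b i) ≠ 0) (ho : ∀ i j, i ≠ j → P (w j) (b i) = 0) :
    LinearIndependent ℂ fun i => S.mkQ (w i) := by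
  classical
  rw [Fintype.linearIndependent_iff]
  intro g hg i
  -- A linear relation modulo S is an element of S, hence killed by P; pairing it with b i isolates
  -- g i.
  have hmem : ∑ j, g j • w j ∈ S := by
    rw [← S.ker_mkQ, LinearMap.mem_ker, map_sum]
    simpa using hg
  have h := hP _ hmem (b i)
  rw [map_sum, LinearMap.sum_apply, Finset.sum_eq_single i] at h
  · rw [map_smul, LinearMap.smul_apply, smul_eq_mul] at h
    exact (mul_eq_zero.1 h).resolve_right (hd i)
  · intro j _ hj
    rw [map_smul, LinearMap.smul_apply, ho i j hj.symm, smul_zero]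
  · simp

/-- `n` vectors independent modulo `S` in the span of `n` vectors `H` and `S` span the same
space modulo `S`; if they are isotropic, then so are the `H`. -/
lemma isotropic_of_span {V ι : Type*} [AddCommGroup V] [Module ℂ V] [Fintype ι]
    (S : Submodule ℂ V) (P : LinearMap.BilinForm ℂ V) (hP : ∀ u ∈ S, ∀ v, P u v = 0)
    (hP' : ∀ u ∈ S, ∀ v, P v u = 0) (w H : ι → V)
    (hw : LinearIndependent ℂ fun i => S.mkQ (w i))
    (hmem : ∀ i, w i ∈ S ⊔ Submodule.span ℂ (Set.range H))
    (hiso : ∀ i j, P (w i) (w j) = 0) (i j : ι) : P (H i) (H j) = 0 := by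
  have key : ∀ (f : ι → V), Submodule.map S.mkQ (Submodule.span ℂ (Set.range f))
      = Submodule.span ℂ (Set.range fun i => S.mkQ (f i)) := by
    intro f
    rw [Submodule.map_span, ← Set.range_comp]
    rfl
  have hle : Submodule.span ℂ (Set.range fun i => S.mkQ (w i))
      ≤ Submodule.span ℂ (Set.range fun i => S.mkQ (H i)) := by
    rw [Submodule.span_le]
    rintro _ ⟨i, rfl⟩
    have := Submodule.mem_map_of_mem (f := S.mkQ) (hmem i)
    rw [Submodule.map_sup, key] at this
    rwa [Submodule.mkQ_map_self, bot_sup_eq] at this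
  have hfin : FiniteDimensional ℂ (Submodule.span ℂ (Set.range fun i => S.mkQ (H i))) :=
    FiniteDimensional.span_of_finite ℂ (Set.finite_range _)
  have heq : Submodule.span ℂ (Set.range fun i => S.mkQ (w i))
      = Submodule.span ℂ (Set.range fun i => S.mkQ (H i)) := by
    -- The smaller span has dimension equal to the number of indices, and the larger one is
    -- generated by as many vectors.
    refine Submodule.eq_of_le_of_finrank_le hle ?_
    rw [finrank_span_eq_card hw]
    exact finrank_range_le_card _
  have hH : ∀ i, ∃ c : ι → ℂ, H i - ∑ j, c j • w j ∈ S := by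
    intro i
    have : S.mkQ (H i) ∈ Submodule.span ℂ (Set.range fun i => S.mkQ (w i)) := by
      rw [heq]
      exact Submodule.subset_span ⟨i, rfl⟩
    obtain ⟨c, hc⟩ := (Submodule.mem_span_range_iff_exists_fun ℂ).1 this
    refine ⟨c, ?_⟩
    rw [← S.ker_mkQ, LinearMap.mem_ker, map_sub, map_sum, sub_eq_zero, ← hc]
    simp
  obtain ⟨c, hc⟩ := hH i
  obtain ⟨d, hd⟩ := hH j
  have h1 : P (H i) (H j) = P (∑ j, c j • w j) (H j) := by
    have := hP _ hc (H j)
    rwa [map_sub, LinearMap.sub_apply, sub_eq_zero] at this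
  have h2 : P (∑ j, c j • w j) (H j) = P (∑ j, c j • w j) (∑ j, d j • w j) := by
    have := hP' _ hd (∑ j, c j • w j)
    rwa [map_sub, sub_eq_zero] at this
  rw [h1, h2]
  simp only [map_sum, map_smul, LinearMap.sum_apply, LinearMap.smul_apply, hiso, smul_zero,
    Finset.sum_const_zero]

/-! ### Generic points -/

/-- `B(λ) / λ` as a polynomial in `λ²`. -/
def sqB (z : Phase n) : ℂ[X] := X ^ n + ∑ i : Fin n, C (z (genB i)) * X ^ (i : ℕ)

/-- `B(λ) / λ`. -/
def redB (z : Phase n) : ℂ[X] := X ^ (2 * n) + ∑ i : Fin n, C (z (genB i)) * X ^ (2 * (i : ℕ))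

lemma redB_eq (z : Phase n) : redB z = (sqB z).comp (X ^ 2) := by
  simp [redB, sqB, Polynomial.sum_comp, pow_mul]

lemma polyB_eq_mul (z : Phase n) : polyB z = X * redB z := by
  rw [polyB, redB, mul_add, Finset.mul_sum, pow_succ', add_right_inj]
  exact Finset.sum_congr rfl fun _ _ => by ring

lemma degree_sqB_sum_lt (z : Phase n) :
    (∑ i : Fin n, C (z (genB i)) * X ^ (i : ℕ)).degree < (n : WithBot ℕ) :=
  degree_sum_fin_lt fun i => z (genB i)

lemma monic_sqB (z : Phase n) : (sqB z).Monic :=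
  monic_X_pow_add (degree_sqB_sum_lt z)

lemma natDegree_sqB (z : Phase n) : (sqB z).natDegree = n := by
  rw [sqB, natDegree_add_eq_left_of_degree_lt, natDegree_X_pow]
  rw [degree_X_pow]
  exact degree_sqB_sum_lt z

lemma natDegree_redB (z : Phase n) : (redB z).natDegree = 2 * n := by
  rw [redB_eq, natDegree_comp, natDegree_sqB, natDegree_X_pow, mul_comm]

lemma monic_redB (z : Phase n) : (redB z).Monic := by
  rw [redB_eq]
  exact (monic_sqB z).comp (monic_X_pow 2) (by simp)

lemma polyFam_redB : PolyFam fun z : Phase n => redB z :=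
  (PolyFam.const _).add (PolyFam.sum _ fun _ => (PolyFam.coord _).mul (PolyFam.const _))

/-- Coprimality to `B(λ) / λ` is a Zariski open condition. -/
lemma exists_mvPolynomial_isCoprime {Q : Phase n → ℂ[X]} (hQ : PolyFam Q) {w : Phase n}
    (hw : IsCoprime (redB w) (Q w)) : ∃ p : MvPolynomial (Gen n) ℂ, p ≠ 0 ∧
      ∀ z, MvPolynomial.eval z p ≠ 0 → IsCoprime (redB z) (Q z) := by
  obtain ⟨b, hb⟩ := polyFam_redB (n := n)
  obtain ⟨q, hq⟩ := hQ
  have key : ∀ z, MvPolynomial.eval z (resultant b q (2 * n) q.natDegree)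
      = resultant (redB z) (Q z) := by
    intro z
    have hle : (Q z).natDegree ≤ q.natDegree := by rw [hq]; exact natDegree_map_le
    rw [← resultant_map_map, ← hb, ← hq]
    obtain ⟨k, hk⟩ := Nat.exists_eq_add_of_le hle
    have h1 : (redB z).coeff (2 * n) = 1 := by
      rw [← natDegree_redB z]; exact monic_redB z
    -- The degree of Q z may drop at special z. Padding it changes the resultant only by a power of
    -- the leading coefficient of B(λ)/λ, which is 1.
    rw [hk, resultant_add_right_deg _ _ _ _ _ le_rfl, h1, one_pow, one_mul, natDegree_redB]
  refine ⟨resultant b q (2 * n) q.natDegree, fun h0 => ?_, fun z hz => ?_⟩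
  · have := key w
    rw [h0, map_zero] at this
    exact ((isUnit_resultant_iff_isCoprime (monic_redB w)).2 hw).ne_zero this.symm
  · rw [key] at hz
    exact (isUnit_resultant_iff_isCoprime (monic_redB z)).1 (isUnit_iff_ne_zero.2 hz)

lemma isCoprime_of_forall_eval {f g : ℂ[X]} (h : ∀ r, f.eval r = 0 → g.eval r ≠ 0) :
    IsCoprime f g := by
  refine (isCoprime_iff_aeval_ne_zero_of_isAlgClosed ℂ ℂ f g).2 fun r => ?_
  simp only [coe_aeval_eq_eval]
  exact or_iff_not_imp_left.2 fun hr => h r (not_not.1 hr)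

lemma eval_ne_zero_of_isCoprime {f g : ℂ[X]} (h : IsCoprime f g) {r : ℂ} (hr : f.eval r = 0) :
    g.eval r ≠ 0 := by
  obtain ⟨u, v, huv⟩ := h
  intro hg
  have := congrArg (eval r) huv
  simp [hr, hg] at this

/-- A point with `B(λ) = λ^{2n+1} - s λ` and `A(λ) = α λ^{2n+1} + p λ + q`. -/
def samplePoint (hn : 1 ≤ n) (s p q : ℂ) : Phase n :=
  Pi.single (genB ⟨0, hn⟩) (-s) + Pi.single (genA ⟨1, by omega⟩) p
    + Pi.single (genA ⟨0, by omega⟩) q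

lemma dA_single (x : ℂ) (a : Gen n) (c : ℂ) : dA x (Pi.single a c) = covA x a * c := by
  simp [dA, cov, Pi.single_apply, -Fintype.sum_sum_type]

lemma redB_samplePoint (hn : 1 ≤ n) (s p q : ℂ) :
    redB (samplePoint hn s p q) = X ^ (2 * n) - C s := by
  rw [redB, sub_eq_add_neg, add_right_inj, Finset.sum_eq_single ⟨0, hn⟩]
  · simp [samplePoint]
  · intro b _ hb
    simp [samplePoint, hb]
  · simp

lemma polyA_samplePoint (hn : 1 ≤ n) (α s p q x : ℂ) :
    (polyA α (samplePoint hn s p q)).eval x = α * x ^ (2 * n + 1) + p * x + q := by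
  rw [polyA_eval, samplePoint, map_add, map_add, dA_single, dA_single, dA_single]
  simp [covA]
  ring

/-- Only 0 and the finitely many powers r^{2n} of roots r of f have to be avoided. -/
lemma exists_avoiding (n : ℕ) {f : ℂ[X]} (hf : f ≠ 0) :
    ∃ s : ℂ, s ≠ 0 ∧ ∀ r : ℂ, r ^ (2 * n) = s → f.eval r ≠ 0 := by
  have hfin : (insert 0 ((fun r : ℂ => r ^ (2 * n)) '' {r | f.IsRoot r})).Finite :=
    ((finite_setOfPred_isRoot hf).image _).insert 0
  obtain ⟨s, hs⟩ := hfin.exists_notMem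
  refine ⟨s, fun h => hs (Or.inl h), fun r hr h => hs (Or.inr ⟨r, h, hr⟩)⟩

/-- For B = λ^{2n+1} - λ one has B'(r) = 2n at every zero r of B(λ)/λ, that is, when r^{2n} = 1. -/
lemma exists_isCoprime_derivative (hn : 1 ≤ n) :
    ∃ w : Phase n, IsCoprime (redB w) (derivative (polyB w)) := by
  refine ⟨samplePoint hn 1 0 0, isCoprime_of_forall_eval fun r hr => ?_⟩
  rw [polyB_eq_mul]
  rw [redB_samplePoint] at hr ⊢
  have h1 : r ^ (2 * n) = 1 := by simpa [sub_eq_zero] using hr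
  have h2 : r ^ (2 * n) = r * r ^ (2 * n - 1) := by
    rw [← pow_succ', Nat.sub_add_cancel (by omega)]
  have h3 : r * (2 * (n : ℂ) * r ^ (2 * n - 1)) = 2 * n := by
    linear_combination 2 * (n : ℂ) * (h1 - h2)
  have h4 : (n : ℂ) ≠ 0 := by exact_mod_cast (by omega : n ≠ 0)
  simp [derivative_X_pow, h1, h3, h4]

lemma exists_isCoprime_combination (hn : 1 ≤ n) (α : ℂ) {a d : ℂ[X]} (had : a ≠ 0 ∨ d ≠ 0) :
    ∃ w : Phase n, IsCoprime (redB w) (a * polyA α w - d * (polyA α w).comp (-X)) := by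
  by_cases h : a = d
  · have ha : a ≠ 0 := by rcases had with h' | h' <;> simpa [h] using h'
    obtain ⟨s, hs0, hs⟩ := exists_avoiding n ha
    -- The choice p = 1 - αs makes A(±r) = ±r whenever r^{2n} = s, so the combination takes the
    -- value 2 r a(r).
    refine ⟨samplePoint hn s (1 - α * s) 0, isCoprime_of_forall_eval fun r hr => ?_⟩
    rw [redB_samplePoint] at hr
    have h1 : r ^ (2 * n) = s := by simpa [sub_eq_zero] using hr
    have hr0 : r ≠ 0 := by
      rintro rfl
      rw [zero_pow (by omega)] at h1
      exact hs0 h1.symm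
    have h2 : eval r (a * polyA α (samplePoint hn s (1 - α * s) 0)
        - d * (polyA α (samplePoint hn s (1 - α * s) 0)).comp (-X)) = a.eval r * (2 * r) := by
      simp only [← h, eval_sub, eval_mul, eval_comp, eval_neg, eval_X, polyA_samplePoint,
        pow_succ, (even_two_mul n).neg_pow, h1]
      ring
    rw [h2]
    exact mul_ne_zero (hs r h1) (mul_ne_zero two_ne_zero hr0)
  · obtain ⟨s, hs0, hs⟩ := exists_avoiding n (sub_ne_zero.2 h)
    -- Here A(±r) = 1 whenever r^{2n} = s, so the combination takes the value a(r) - d(r).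
    refine ⟨samplePoint hn s (-α * s) 1, isCoprime_of_forall_eval fun r hr => ?_⟩
    rw [redB_samplePoint] at hr
    have h1 : r ^ (2 * n) = s := by simpa [sub_eq_zero] using hr
    have h2 : eval r (a * polyA α (samplePoint hn s (-α * s) 1)
        - d * (polyA α (samplePoint hn s (-α * s) 1)).comp (-X)) = (a - d).eval r := by
      simp only [eval_sub, eval_mul, eval_comp, eval_neg, eval_X, polyA_samplePoint,
        pow_succ, (even_two_mul n).neg_pow, h1]
      ring
    rw [h2]
    exact hs r h1

/-- `r` represents the zeros `±r_j` of `B(λ) / λ`, and `z` is generic. -/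
structure GenericRoots (α : ℂ) (z : Phase n) (r : Fin n → ℂ) : Prop where
  root : ∀ j, (polyB z).eval (r j) = 0
  ne_zero : ∀ j, r j ≠ 0
  sq_ne : ∀ i j, i ≠ j → r i ^ 2 ≠ r j ^ 2
  deriv_ne : ∀ j, (derivative (polyB z)).eval (r j) ≠ 0
  A_ne : ∀ j, (polyA α z).eval (r j) ≠ 0

/-- At a zero r of B(λ)/λ = b(λ²) one has B'(r) = 2 r² b'(r²). So coprimality forces r ≠ 0 and
simple roots of b; there are n of these, and r_j is a chosen square root of each. -/
lemma exists_roots_of_isCoprime {z : Phase n} (h : IsCoprime (redB z) (derivative (polyB z))) :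
    ∃ r : Fin n → ℂ, (∀ j, (redB z).eval (r j) = 0) ∧ (∀ j, r j ≠ 0) ∧
      ∀ i j, i ≠ j → r i ^ 2 ≠ r j ^ 2 := by
  have hr : ∀ r, (redB z).eval r = 0 → r ≠ 0 ∧ (derivative (sqB z)).eval (r ^ 2) ≠ 0 := by
    intro r h0
    have := eval_ne_zero_of_isCoprime h h0
    rw [polyB_eq_mul, derivative_mul] at this
    simp only [derivative_X, one_mul, eval_add, h0, eval_mul, eval_X, zero_add] at this
    refine ⟨left_ne_zero_of_mul this, fun h' => right_ne_zero_of_mul this ?_⟩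
    rw [redB_eq, derivative_comp, eval_mul, eval_comp]
    simp [h']
  have hnodup : (sqB z).roots.Nodup := by
    rw [Multiset.nodup_iff_count_le_one]
    intro s
    rw [count_roots]
    by_contra! hlt
    obtain ⟨h1, h2⟩ := (one_lt_rootMultiplicity_iff_isRoot (monic_sqB z).ne_zero).1 hlt
    obtain ⟨r, rfl⟩ := IsAlgClosed.exists_pow_nat_eq s two_pos
    exact (hr r (by simpa [redB_eq, eval_comp] using h1)).2 h2
  have hcard : (sqB z).roots.toFinset.card = n := by
    rw [Multiset.toFinset_card_of_nodup hnodup,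
      ← (IsAlgClosed.splits (sqB z)).natDegree_eq_card_roots, natDegree_sqB]
  let e := (sqB z).roots.toFinset.equivFinOfCardEq hcard
  have hsq : ∀ j : Fin n, ∃ r : ℂ, r ^ 2 = e.symm j :=
    fun j => IsAlgClosed.exists_pow_nat_eq _ two_pos
  choose r hsq using hsq
  have hroot : ∀ j, (redB z).eval (r j) = 0 := by
    intro j
    have := (e.symm j).2
    rw [Multiset.mem_toFinset, mem_roots (monic_sqB z).ne_zero] at this
    rw [redB_eq, eval_comp]
    simpa [hsq] using this
  refine ⟨r, hroot, fun j => (hr _ (hroot j)).1, fun i j hij h' => hij ?_⟩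
  rw [hsq, hsq] at h'
  exact e.symm.injective (Subtype.ext h')

/-- Generic points exist in every nonempty open set. -/
lemma exists_open_generic (hn : 1 ≤ n) (α : ℂ) (a d : ℂ[X]) {V : Set (Phase n)} (hV : IsOpen V)
    (hne : V.Nonempty) : ∃ V' ⊆ V, IsOpen V' ∧ V'.Nonempty ∧ ∀ z ∈ V', ∃ r : Fin n → ℂ,
      GenericRoots α z r ∧ ((a ≠ 0 ∨ d ≠ 0) → ∀ j, a.eval (r j) * (polyA α z).eval (r j)
        - d.eval (r j) * (polyA α z).eval (-r j) ≠ 0) := by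
  have fam : ∀ a d : ℂ[X], PolyFam fun z : Phase n =>
      a * polyA α z - d * (polyA α z).comp (-X) := fun a d =>
    ((PolyFam.const _).mul (polyFam_A α)).sub ((PolyFam.const _).mul (polyFam_A α).comp_neg)
  obtain ⟨p₁, h₁, hp₁⟩ := exists_mvPolynomial_isCoprime polyFam_B.derivative
    (exists_isCoprime_derivative hn).choose_spec
  -- For a = 1, d = 0 the combination is A itself; this yields A(r_j) ≠ 0.
  obtain ⟨p₂, h₂, hp₂⟩ := exists_mvPolynomial_isCoprime (fam 1 0)
    (exists_isCoprime_combination hn α (a := 1) (d := 0) (Or.inl one_ne_zero)).choose_spec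
  obtain ⟨p₃, h₃, hp₃⟩ : ∃ p : MvPolynomial (Gen n) ℂ, p ≠ 0 ∧ ∀ z, MvPolynomial.eval z p ≠ 0 →
      (a ≠ 0 ∨ d ≠ 0) → IsCoprime (redB z) (a * polyA α z - d * (polyA α z).comp (-X)) := by
    by_cases had : a ≠ 0 ∨ d ≠ 0
    · obtain ⟨p, h, hp⟩ := exists_mvPolynomial_isCoprime (fam a d)
        (exists_isCoprime_combination hn α had).choose_spec
      exact ⟨p, h, fun z hz _ => hp z hz⟩
    · exact ⟨1, one_ne_zero, fun _ _ h => absurd h had⟩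
  obtain ⟨z₀, hz₀, hz₀'⟩ := exists_eval_ne_zero (mul_ne_zero (mul_ne_zero h₁ h₂) h₃) hV hne
  refine ⟨V ∩ {z | MvPolynomial.eval z (p₁ * p₂ * p₃) ≠ 0}, Set.inter_subset_left,
    hV.inter (isOpen_ne_fun (MvPolynomial.continuous_eval _) continuous_const), ⟨z₀, hz₀, hz₀'⟩, ?_⟩
  rintro z ⟨-, hz⟩
  simp only [Set.mem_ofPred_eq, map_mul, mul_ne_zero_iff] at hz
  have c₁ := hp₁ z hz.1.1
  have c₂ := hp₂ z hz.1.2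
  obtain ⟨r, hr, hr0, hrij⟩ := exists_roots_of_isCoprime c₁
  refine ⟨r, ⟨fun j => ?_, hr0, hrij, fun j => eval_ne_zero_of_isCoprime c₁ (hr j), fun j => ?_⟩,
    fun had j => ?_⟩
  · rw [polyB_eq_mul, eval_mul, hr j, mul_zero]
  · simpa using eval_ne_zero_of_isCoprime c₂ (hr j)
  · simpa [eval_comp] using eval_ne_zero_of_isCoprime (hp₃ z hz.2 had) (hr j)

/-! ### The coefficients of `τ(λ)` -/

/-- The polynomial `c(λ)` at the point `z`. -/
def polyK (c : (Phase n → ℂ)[X]) (z : Phase n) : ℂ[X] :=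
  c.map (Pi.evalRingHom (fun _ : Phase n => ℂ) z)

lemma polyK_coeff (c : (Phase n → ℂ)[X]) (z : Phase n) (l : ℕ) :
    (polyK c z).coeff l = c.coeff l z := by
  simp [polyK]

lemma polyK_eval (c : (Phase n → ℂ)[X]) (z : Phase n) (x : ℂ) :
    (polyK c z).eval x = ∑ l ∈ Finset.range (c.natDegree + 1), c.coeff l z * x ^ l := by
  rw [eval_eq_sum_range' (n := c.natDegree + 1)]
  · simp only [polyK_coeff]
  · exact Nat.lt_succ_of_le natDegree_map_le

/-- The polynomial `τ(λ)` at the point `z`. -/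
def tau (α : ℂ) (a d : ℂ[X]) (c : (Phase n → ℂ)[X]) (z : Phase n) : ℂ[X] :=
  (matK a d c z * matT α z).trace

lemma tau_eq (α : ℂ) (a d : ℂ[X]) (c : (Phase n → ℂ)[X]) (z : Phase n) :
    tau α a d c z = a * polyA α z + polyK c z * polyB z + d * (polyA α z).comp (-X) := by
  simp [tau, matK, matT, Matrix.trace_fin_two, polyK]
  ring

section tau

variable {α : ℂ} {a d : ℂ[X]} {c : (Phase n → ℂ)[X]} {U : Set (Phase n)}

lemma exists_natDegree_tau_lt (α : ℂ) (a d : ℂ[X]) (c : (Phase n → ℂ)[X]) :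
    ∃ L, ∀ z, (tau α a d c z).natDegree < L := by
  have h : PolyFam fun z : Phase n => a * polyA α z + d * (polyA α z).comp (-X) :=
    ((PolyFam.const _).mul (polyFam_A α)).add ((PolyFam.const _).mul (polyFam_A α).comp_neg)
  obtain ⟨L, hL⟩ := h.exists_natDegree_lt
  refine ⟨max L (c.natDegree + (2 * n + 1) + 1), fun z => ?_⟩
  have hz : tau α a d c z = (a * polyA α z + d * (polyA α z).comp (-X))
      + polyK c z * polyB z := by rw [tau_eq]; ring
  rw [hz]
  refine (natDegree_add_le _ _).trans_lt (max_lt (lt_max_of_lt_left (hL z))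
    (lt_max_of_lt_right (Nat.lt_succ_of_le ?_)))
  exact natDegree_mul_le_of_le natDegree_map_le (natDegree_polyB z)

lemma analyticOnNhd_tauCoeff (hc : ∀ l, AnalyticOnNhd ℂ (c.coeff l) U) (l : ℕ) :
    AnalyticOnNhd ℂ (tauCoeff α a d c l) U := by
  have h1 := ((PolyFam.const a).mul (polyFam_A (n := n) α)).analyticOnNhd_coeff l U
  have h2 := ((PolyFam.const d).mul (polyFam_A (n := n) α).comp_neg).analyticOnNhd_coeff l U
  have h3 : AnalyticOnNhd ℂ (fun z : Phase n => (polyK c z * polyB z).coeff l) U := by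
    simp only [coeff_mul, polyK_coeff]
    exact Finset.analyticOnNhd_fun_sum _ fun x _ =>
      (hc x.1).mul (polyFam_B.analyticOnNhd_coeff x.2 U)
  have h : tauCoeff α a d c l = fun z => (a * polyA α z).coeff l
      + (polyK c z * polyB z).coeff l + (d * (polyA α z).comp (-X)).coeff l := by
    ext z
    change (tau α a d c z).coeff l = _
    rw [tau_eq, coeff_add, coeff_add]
  rw [h]
  exact (h1.add h3).add h2

/-- By the product rule the differential of the coefficient c appears multiplied by B(x), which is
zero at the point z. This is why c may depend on the dynamical variables. -/
lemma hasFDerivAt_tau (hc : ∀ l, AnalyticOnNhd ℂ (c.coeff l) U) {z : Phase n}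
    (hz : z ∈ U) {x : ℂ} (hx : (polyB z).eval x = 0) :
    HasFDerivAt (fun z => (tau α a d c z).eval x)
      (a.eval x • dA x + (polyK c z).eval x • dB x + d.eval x • dA (-x)) z := by
  have h : (fun z : Phase n => (tau α a d c z).eval x) = fun z => a.eval x * (polyA α z).eval x
      + (polyK c z).eval x * (polyB z).eval x + d.eval x * (polyA α z).eval (-x) := by
    ext z
    simp [tau_eq, eval_comp]
  have hK : DifferentiableAt ℂ (fun z => (polyK c z).eval x) z := by
    simp only [polyK_eval]
    exact DifferentiableAt.fun_sum fun l _ => ((hc l z hz).differentiableAt).mul_const _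
  rw [h]
  refine ((((hasFDerivAt_A α z x).const_mul _).add (hK.hasFDerivAt.mul (hasFDerivAt_B z x))).add
    ((hasFDerivAt_A α z (-x)).const_mul _)).congr_fderiv ?_
  ext v
  simp [hx]

/-! ### Separation of variables -/

/-- For i ≠ j all four pairings vanish, since r_i² ≠ r_j² also gives r_i + r_j ≠ 0. For i = j the
two mixed terms cancel by antisymmetry. -/
lemma poisson_separated (hn : 1 ≤ n) (η : ℂ) (k : Fin 2) {z : Phase n} {r : Fin n → ℂ}
    (hr : GenericRoots α z r) (s t : Fin n → ℂ) (i j : Fin n) :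
    poisson α η k z (s i • dA (r i) + t i • dB (r i)) (s j • dA (r j) + t j • dB (r j)) = 0 := by
  have hAA : poisson α η k z (dA (r i)) (dA (r j)) = 0 := by
    rw [poisson_apply, dA, dA, comps_cov, comps_cov]
    refine pairing_AA_zero hn α η k z (hr.root i) (hr.root j) fun h => ?_
    by_cases hij : i = j
    · subst hij
      exact hr.ne_zero i (by linear_combination h / 2)
    · exact hr.sq_ne i j hij (by linear_combination (r i - r j) * h)
  have hBB : poisson α η k z (dB (r i)) (dB (r j)) = 0 := by
    rw [poisson_apply, dB, dB, comps_cov, comps_cov, pairing_BB]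
  have hAB : ∀ {i j}, i ≠ j → poisson α η k z (dA (r i)) (dB (r j)) = 0 := by
    intro i j hij
    rw [poisson_apply, dA, dB, comps_cov, comps_cov]
    exact pairing_AB_zero hn α η k z (hr.root i) (hr.root j) (hr.sq_ne i j hij)
  simp only [map_add, map_smul, LinearMap.add_apply, LinearMap.smul_apply, smul_eq_mul, hAA, hBB]
  rw [poisson_antisymm α η k z (dB (r i))]
  by_cases hij : i = j
  · subst hij
    ring
  · rw [hAB hij, hAB (Ne.symm hij)]
    ring

lemma poisson_dA_dB_ne (hn : 1 ≤ n) {z : Phase n} {r : Fin n → ℂ}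
    (hr : GenericRoots α z r) (i : Fin n) : poisson α 1 0 z (dA (r i)) (dB (r i)) ≠ 0 := by
  rw [poisson_apply, dA, dB, comps_cov, comps_cov,
    pairing_AB_diag hn α 1 z (hr.ne_zero i) (hr.root i)]
  exact mul_ne_zero (mul_ne_zero (by norm_num) (hr.A_ne i)) (hr.deriv_ne i)

lemma poisson_dA_dB_of_ne (hn : 1 ≤ n) {z : Phase n} {r : Fin n → ℂ}
    (hr : GenericRoots α z r) {i j : Fin n} (hij : i ≠ j) :
    poisson α 1 0 z (dA (r i)) (dB (r j)) = 0 := by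
  rw [poisson_apply, dA, dB, comps_cov, comps_cov]
  exact pairing_AB_zero hn α 1 0 z (hr.root i) (hr.root j) (hr.sq_ne i j hij)

/-- The test form is the bracket with k = 0 and η = 1, paired against dB(r_i): it kills the Casimir
differentials and the dB parts and is diagonal on the dA parts. -/
lemma linearIndependent_of_ne_zero (hn : 1 ≤ n) {z : Phase n} {r : Fin n → ℂ}
    (hr : GenericRoots α z r) (s t : Fin n → ℂ) (hs : ∀ i, s i ≠ 0) :
    LinearIndependent ℂ fun i => (casimirSpan α z).mkQ (s i • dA (r i) + t i • dB (r i)) := by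
  have hBB : ∀ i j, poisson α 1 0 z (dB (r i)) (dB (r j)) = 0 := fun i j => by
    rw [poisson_apply, dB, dB, comps_cov, comps_cov, pairing_BB]
  refine linearIndependent_mkQ _ (poisson α 1 0 z) (fun u hu v => poisson_casimir hn α 1 0 z hu v)
    _ (fun i => dB (r i)) (fun i => ?_) fun i j hij => ?_
  · simp only [map_add, map_smul, LinearMap.add_apply, LinearMap.smul_apply, smul_eq_mul, hBB,
      mul_zero, add_zero]
    exact mul_ne_zero (hs i) (poisson_dA_dB_ne hn hr i)
  · simp only [map_add, map_smul, LinearMap.add_apply, LinearMap.smul_apply, smul_eq_mul, hBB,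
      poisson_dA_dB_of_ne hn hr hij.symm, mul_zero, add_zero]

lemma linearIndependent_dB (hn : 1 ≤ n) {z : Phase n} {r : Fin n → ℂ}
    (hr : GenericRoots α z r) :
    LinearIndependent ℂ fun i => (casimirSpan α z).mkQ (dB (r i)) := by
  refine linearIndependent_mkQ _ (poisson α 1 0 z) (fun u hu v => poisson_casimir hn α 1 0 z hu v)
    _ (fun i => dA (r i)) (fun i => ?_) fun i j hij => ?_
  · rw [poisson_antisymm, neg_ne_zero]
    exact poisson_dA_dB_ne hn hr i
  · rw [poisson_antisymm, poisson_dA_dB_of_ne hn hr hij, neg_zero]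

/-- The space spanned by the differentials of the Casimir functions and of the `H_i`. -/
def integralSpan (α : ℂ) (H : Fin n → Phase n → ℂ) (z : Phase n) :
    Submodule ℂ (Phase n →L[ℂ] ℂ) :=
  casimirSpan α z ⊔ Submodule.span ℂ (Set.range fun i => fderiv ℂ (H i) z)

lemma bracket_eq_zero_of_separated (hn : 1 ≤ n) (η : ℂ) (k : Fin 2) {z : Phase n} {r : Fin n → ℂ}
    (hr : GenericRoots α z r) (s t : Fin n → ℂ) (H : Fin n → Phase n → ℂ)
    (hw : LinearIndependent ℂ fun i => (casimirSpan α z).mkQ (s i • dA (r i) + t i • dB (r i)))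
    (hmem : ∀ i, s i • dA (r i) + t i • dB (r i) ∈ integralSpan α H z) (i j : Fin n) :
    bracket α η k (H i) (H j) z = 0 := by
  rw [bracket_eq]
  exact isotropic_of_span _ (poisson α η k z) (fun u hu v => poisson_casimir hn α η k z hu v)
    (fun u hu v => poisson_casimir_right hn α η k z hu v) _ (fun i => fderiv ℂ (H i) z) hw hmem
    (poisson_separated hn η k hr s t) i j

/-- The brackets vanish at a generic point if the diagonal of `K(λ)` is not identically zero. -/
lemma bracket_eq_zero_of_diagonal (hn : 1 ≤ n) (η : ℂ) (k : Fin 2)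
    (hc : ∀ l, AnalyticOnNhd ℂ (c.coeff l) U) {z : Phase n} (hz : z ∈ U) {r : Fin n → ℂ}
    (hr : GenericRoots α z r) (had : ∀ j, a.eval (r j) * (polyA α z).eval (r j)
        - d.eval (r j) * (polyA α z).eval (-r j) ≠ 0) (H : Fin n → Phase n → ℂ)
    (hdep : ∀ l, DependentAt α H (tauCoeff α a d c l) z) (i j : Fin n) :
    bracket α η k (H i) (H j) z = 0 := by
  obtain ⟨L, hL⟩ := exists_natDegree_tau_lt α a d c
  -- These are the coefficients left after subtracting d(r_j)/A(r_j) times the differential of det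
  -- T(r_j), which removes dA(-r_j) from the differential of τ(r_j).
  set s : Fin n → ℂ := fun j => ((polyA α z).eval (r j))⁻¹ *
    (a.eval (r j) * (polyA α z).eval (r j) - d.eval (r j) * (polyA α z).eval (-r j)) with hs
  set t : Fin n → ℂ := fun j => (polyK c z).eval (r j)
    + ((polyA α z).eval (r j))⁻¹ * d.eval (r j) * (polyC z).eval (r j) with ht
  refine bracket_eq_zero_of_separated hn η k hr s t H (linearIndependent_of_ne_zero hn hr s t
    fun j => mul_ne_zero (inv_ne_zero (hr.A_ne j)) (had j)) (fun j => ?_) i j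
  have hv := sum_fderiv_coeff hL
    (fun l => ((analyticOnNhd_tauCoeff hc l) z hz).differentiableAt)
    (hasFDerivAt_tau (α := α) (a := a) (d := d) hc hz (hr.root j))
  have h1 : a.eval (r j) • dA (r j) + (polyK c z).eval (r j) • dB (r j)
      + d.eval (r j) • dA (-r j) ∈ integralSpan α H z := by
    rw [← hv]
    exact Submodule.sum_mem _ fun l _ => Submodule.smul_mem _ _ (hdep l)
  have h2 : dDet α z (r j) ∈ integralSpan α H z :=
    Submodule.mem_sup_left (dDet_mem α z (r j))
  have h3 : s j • dA (r j) + t j • dB (r j) = (a.eval (r j) • dA (r j)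
      + (polyK c z).eval (r j) • dB (r j) + d.eval (r j) • dA (-r j))
      - (((polyA α z).eval (r j))⁻¹ * d.eval (r j)) • dDet α z (r j) := by
    have hA := hr.A_ne j
    rw [dDet, hr.root j]
    ext v
    simp [hs, ht]
    field_simp
    ring
  rw [h3]
  exact sub_mem h1 (Submodule.smul_mem _ _ h2)

end tau

/-! ### Integral dependence and differentials -/

/-- If `x` satisfies a polynomial equation of degree `m`, whose coefficients have differentials in
`T` and whose top coefficient is a nonzero constant, then generically the differential of `x` lies
in `T`. -/
lemma exists_open_fderiv_mem {E : Type*} [NormedAddCommGroup E] [NormedSpace ℂ E]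
    (T : E → Submodule ℂ (E →L[ℂ] ℂ)) (x : E → ℂ) (ξ : E → (E →L[ℂ] ℂ))
    (hx : ∀ z, HasFDerivAt x (ξ z) z) {V : Set E} (hV : IsOpen V) (hne : V.Nonempty) (m : ℕ)
    (g : ℕ → E → ℂ) (hg : ∀ i, ∀ z ∈ V, ∃ D ∈ T z, HasFDerivAt (g i) D z) {κ : ℂ} (hκ : κ ≠ 0)
    (hm : ∀ z ∈ V, g m z = κ)
    (h0 : ∀ z ∈ V, ∑ i ∈ Finset.range (m + 1), g i z * x z ^ i = 0) :
    ∃ V' ⊆ V, IsOpen V' ∧ V'.Nonempty ∧ ∀ z ∈ V', ξ z ∈ T z := by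
  induction m generalizing g κ with
  | zero =>
    obtain ⟨z, hz⟩ := hne
    have := h0 z hz
    simp [hm z hz, hκ] at this
  | succ m ih =>
    set q : E → ℂ := fun z => ∑ i ∈ Finset.range (m + 1), ((i : ℂ) + 1) * g (i + 1) z * x z ^ i
      with hq
    -- Here q is the derivative of the equation with respect to x. If it vanishes identically, it is
    -- an equation of lower degree with constant top coefficient (m + 1)κ. Otherwise, where q ≠ 0,
    -- differentiating the equation expresses the differential of x through those of the
    -- coefficients.
    by_cases hz : ∀ z ∈ V, q z = 0
    · refine ih (fun i z => ((i : ℂ) + 1) * g (i + 1) z) (fun i z hz => ?_) (κ := (m + 1) * κ)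
        (mul_ne_zero (by exact_mod_cast Nat.succ_ne_zero m) hκ) (fun z hz => ?_) hz
      · obtain ⟨D, hD, hd⟩ := hg (i + 1) z hz
        exact ⟨_, Submodule.smul_mem _ _ hD, hd.const_mul _⟩
      · simp [hm z hz]
    · push Not at hz
      obtain ⟨z₀, hz₀, hqz₀⟩ := hz
      have hcont : ContinuousOn q V := by
        refine continuousOn_finsetSum _ fun i _ => ?_
        refine (continuousOn_const.mul fun z hz => ?_).mul fun z _ =>
          ((hx z).continuousAt.pow i).continuousWithinAt
        obtain ⟨D, -, hd⟩ := hg (i + 1) z hz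
        exact hd.continuousAt.continuousWithinAt
      refine ⟨V ∩ q ⁻¹' {0}ᶜ, Set.inter_subset_left,
        hcont.isOpen_inter_preimage hV isOpen_compl_singleton, ⟨z₀, hz₀, hqz₀⟩, ?_⟩
      rintro z ⟨hzV, hqz⟩
      choose D hDT hD using fun i => hg i z hzV
      have hder : HasFDerivAt (fun z => ∑ i ∈ Finset.range (m + 1 + 1), g i z * x z ^ i)
          (∑ i ∈ Finset.range (m + 1 + 1), (g i z • ((i • x z ^ (i - 1)) • ξ z)
            + x z ^ i • D i)) z :=
        HasFDerivAt.fun_sum fun i _ => (hD i).mul ((hx z).pow i)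
      have hzero : HasFDerivAt (fun z => ∑ i ∈ Finset.range (m + 1 + 1), g i z * x z ^ i)
          (0 : E →L[ℂ] ℂ) z := by
        refine (hasFDerivAt_const (0 : ℂ) z).congr_of_eventuallyEq ?_
        filter_upwards [hV.mem_nhds hzV] with y hy using h0 y hy
      have heq := hder.unique hzero
      rw [Finset.sum_add_distrib, Finset.sum_range_succ'] at heq
      have hqs : ∑ i ∈ Finset.range (m + 1), g (i + 1) z • (((i + 1) • x z ^ (i + 1 - 1)) • ξ z)
          = q z • ξ z := by
        ext v
        simp only [hq, sum_apply, smul_apply, smul_eq_mul,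
          Finset.sum_mul, nsmul_eq_mul, Nat.add_sub_cancel]
        refine Finset.sum_congr rfl fun i _ => ?_
        push_cast
        ring
      have hq0 : g 0 z • ((0 • x z ^ (0 - 1)) • ξ z) = 0 := by
        ext v
        simp
      rw [hqs, hq0, add_zero] at heq
      have hmem : q z • ξ z ∈ T z := by
        have h1 : q z • ξ z = -∑ i ∈ Finset.range (m + 1 + 1), x z ^ i • D i := by
          rw [eq_neg_iff_add_eq_zero, ← heq]
        rw [h1]
        exact neg_mem (Submodule.sum_mem _ fun i _ => Submodule.smul_mem _ _ (hDT i))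
      exact (Submodule.smul_mem_iff _ hqz).1 hmem

/-- Finitely many generic conditions hold simultaneously on a nonempty open set. -/
lemma exists_open_forall {E ι : Type*} [TopologicalSpace E] [Finite ι] (Q : ι → E → Prop)
    {V : Set E} (hV : IsOpen V) (hne : V.Nonempty)
    (h : ∀ i, ∀ W ⊆ V, IsOpen W → W.Nonempty →
      ∃ W' ⊆ W, IsOpen W' ∧ W'.Nonempty ∧ ∀ z ∈ W', Q i z) :
    ∃ W ⊆ V, IsOpen W ∧ W.Nonempty ∧ ∀ z ∈ W, ∀ i, Q i z := by
  classical
  cases nonempty_fintype ι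
  have key : ∀ s : Finset ι, ∃ W ⊆ V, IsOpen W ∧ W.Nonempty ∧ ∀ z ∈ W, ∀ i ∈ s, Q i z := by
    intro s
    induction s using Finset.induction_on with
    | empty => exact ⟨V, le_rfl, hV, hne, by simp⟩
    | insert i s _ ih =>
      obtain ⟨W, hWV, hW, hWne, hWQ⟩ := ih
      obtain ⟨W', hW'W, hW', hW'ne, hW'Q⟩ := h i W hWV hW hWne
      refine ⟨W', hW'W.trans hWV, hW', hW'ne, fun z hz j hj => ?_⟩
      rcases Finset.mem_insert.1 hj with rfl | hj
      · exact hW'Q z hz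
      · exact hWQ z (hW'W hz) j hj
  obtain ⟨W, hWV, hW, hWne, hWQ⟩ := key Finset.univ
  exact ⟨W, hWV, hW, hWne, fun z hz i => hWQ z hz i (Finset.mem_univ i)⟩

/-- The functions on `V` which extend to functions with differentials in `T`. -/
def closedSubring {E : Type*} [NormedAddCommGroup E] [NormedSpace ℂ E]
    (T : E → Submodule ℂ (E →L[ℂ] ℂ)) (V : Set E) : Subring (V → ℂ) where
  carrier := {g | ∃ G : E → ℂ, (∀ z : V, G z = g z) ∧ ∀ z ∈ V, ∃ D ∈ T z, HasFDerivAt G D z}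
  mul_mem' := by
    rintro g h ⟨G, hG, hG'⟩ ⟨H, hH, hH'⟩
    refine ⟨fun z => G z * H z, fun z => by simp [hG, hH], fun z hz => ?_⟩
    obtain ⟨D, hD, hD'⟩ := hG' z hz
    obtain ⟨D₁, hD₁, hD₁'⟩ := hH' z hz
    exact ⟨_, add_mem (Submodule.smul_mem _ _ hD₁) (Submodule.smul_mem _ _ hD), hD'.mul hD₁'⟩
  one_mem' := ⟨fun _ => 1, fun _ => rfl, fun z _ => ⟨0, zero_mem _, hasFDerivAt_const _ z⟩⟩
  add_mem' := by
    rintro g h ⟨G, hG, hG'⟩ ⟨H, hH, hH'⟩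
    refine ⟨fun z => G z + H z, fun z => by simp [hG, hH], fun z hz => ?_⟩
    obtain ⟨D, hD, hD'⟩ := hG' z hz
    obtain ⟨D₁, hD₁, hD₁'⟩ := hH' z hz
    exact ⟨_, add_mem hD hD₁, hD'.add hD₁'⟩
  zero_mem' := ⟨fun _ => 0, fun _ => rfl, fun z _ => ⟨0, zero_mem _, hasFDerivAt_const _ z⟩⟩
  neg_mem' := by
    rintro g ⟨G, hG, hG'⟩
    refine ⟨fun z => -G z, fun z => by simp [hG], fun z hz => ?_⟩
    obtain ⟨D, hD, hD'⟩ := hG' z hz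
    exact ⟨_, neg_mem hD, hD'.neg⟩

/-- The differential of a function integral over `closedSubring T V` generically lies in `T`. -/
lemma exists_open_fderiv_mem_of_isIntegral {E : Type*} [NormedAddCommGroup E] [NormedSpace ℂ E]
    (T : E → Submodule ℂ (E →L[ℂ] ℂ)) {V W : Set E} (hWV : W ⊆ V) (hW : IsOpen W)
    (hne : W.Nonempty) (x : E → ℂ) (ξ : E → (E →L[ℂ] ℂ)) (hx : ∀ z, HasFDerivAt x (ξ z) z)
    (hint : IsIntegral (closedSubring T V) (fun z : V => x z)) :
    ∃ W' ⊆ W, IsOpen W' ∧ W'.Nonempty ∧ ∀ z ∈ W', ξ z ∈ T z := by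
  obtain ⟨p, hp, hp0⟩ := hint
  choose G hG hG' using fun i => (p.coeff i).2
  refine exists_open_fderiv_mem T x ξ hx hW hne p.natDegree G (fun i z hz => hG' i z (hWV hz))
    one_ne_zero (fun z hz => ?_) fun z hz => ?_
  · rw [hG p.natDegree ⟨z, hWV hz⟩, coeff_natDegree, hp]
    rfl
  · rw [eval₂_eq_sum_range] at hp0
    have := congrFun hp0 ⟨z, hWV hz⟩
    rw [Finset.sum_apply] at this
    rw [← Pi.zero_apply (M := fun _ : V => ℂ) ⟨z, hWV hz⟩, ← this]
    exact Finset.sum_congr rfl fun i _ => by rw [hG i ⟨z, hWV hz⟩]; rfl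

/-! ### Boundary matrices with zero diagonal: τ(λ) = c(λ) B(λ) -/

section offDiagonal

variable {α : ℂ} {c : (Phase n → ℂ)[X]} {U : Set (Phase n)}

/-- The span of the differentials of the coefficients of `τ(λ) = c(λ) B(λ)`. -/
def tauSpan (α : ℂ) (c : (Phase n → ℂ)[X]) (z : Phase n) : Submodule ℂ (Phase n →L[ℂ] ℂ) :=
  Submodule.span ℂ (Set.range fun l => fderiv ℂ (tauCoeff α 0 0 c l) z)

lemma tau_zero_zero (z : Phase n) : tau α 0 0 c z = polyK c z * polyB z := by
  rw [tau_eq]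
  ring

/-- `B(λ)` over the ring of functions on `V`. -/
def polyBOn (V : Set (Phase n)) : (V → ℂ)[X] :=
  X ^ (2 * n + 1) + ∑ i : Fin n, C (fun z : V => z.1 (genB i)) * X ^ (2 * (i : ℕ) + 1)

/-- `c(λ)` over the ring of functions on `V`. -/
def polyKOn (c : (Phase n → ℂ)[X]) (V : Set (Phase n)) : (V → ℂ)[X] :=
  c.map (RingHom.pi fun z : V => Pi.evalRingHom (fun _ : Phase n => ℂ) z)

lemma polyBOn_map (V : Set (Phase n)) (z : V) :
    (polyBOn V).map (Pi.evalRingHom (fun _ : V => ℂ) z) = polyB (z : Phase n) := by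
  simp [polyBOn, polyB, Polynomial.map_sum]

lemma polyKOn_map (V : Set (Phase n)) (z : V) :
    (polyKOn c V).map (Pi.evalRingHom (fun _ : V => ℂ) z) = polyK c z := by
  rw [polyKOn, Polynomial.map_map]
  rfl

lemma monic_polyBOn (V : Set (Phase n)) : (polyBOn V).Monic := by
  refine monic_X_pow_add ((degree_lt_iff_coeff_zero _ _).2 fun m hm => ?_)
  rw [finsetSum_coeff]
  refine Finset.sum_eq_zero fun i _ => ?_
  rw [coeff_C_mul, coeff_X_pow, if_neg (by omega), mul_zero]

lemma polyBOn_coeff (V : Set (Phase n)) (i : Fin n) :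
    (polyBOn V).coeff (2 * (i : ℕ) + 1) = fun z : V => z.1 (genB i) := by
  rw [polyBOn, coeff_add, coeff_X_pow, if_neg (by omega), zero_add, finsetSum_coeff,
    Finset.sum_eq_single i]
  · rw [coeff_C_mul, coeff_X_pow, if_pos rfl, mul_one]
  · intro j _ hj
    rw [coeff_C_mul, coeff_X_pow, if_neg (fun h => hj (Fin.ext (by omega))), mul_zero]
  · simp

lemma tauCoeff_eq_coeff (V : Set (Phase n)) (l : ℕ) (z : V) :
    (polyKOn c V * polyBOn V).coeff l z = tauCoeff α 0 0 c l z := by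
  have h : ((polyKOn c V * polyBOn V).map (Pi.evalRingHom (fun _ : V => ℂ) z)).coeff l
      = (tau α 0 0 c z).coeff l := by
    rw [Polynomial.map_mul, polyBOn_map, polyKOn_map, tau_zero_zero]
  rwa [coeff_map] at h

/-- If `K(λ)` has no diagonal part, then generically the differentials of `B_1, …, B_n` lie in the
span of the differentials of the coefficients of `τ(λ)`. -/
lemma exists_open_dB_mem (hc : ∀ l, AnalyticOnNhd ℂ (c.coeff l) U) {V : Set (Phase n)}
    (hVU : V ⊆ U) (hV : IsOpen V)
    (hc0 : ∃ l, ∃ z ∈ V, c.coeff l z ≠ 0) :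
    ∃ W ⊆ V, IsOpen W ∧ W.Nonempty ∧ ∀ z ∈ W, ∀ x, dB x ∈ tauSpan α c z := by
  classical
  -- N is the degree of c over V, which can be less than `c.natDegree` because coefficients may
  -- vanish identically on V.
  obtain ⟨N, ⟨z₁, hz₁, hz₁'⟩, hNmax⟩ : ∃ N, (∃ z ∈ V, c.coeff N z ≠ 0) ∧
      ∀ m, N < m → ∀ z ∈ V, c.coeff m z = 0 := by
    have hbound : ∀ l, (∃ z ∈ V, c.coeff l z ≠ 0) → l ≤ c.natDegree := by
      rintro l ⟨z, -, h⟩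
      by_contra! hl
      exact h (by rw [coeff_eq_zero_of_natDegree_lt hl]; rfl)
    obtain ⟨l, hl⟩ := hc0
    refine ⟨Nat.findGreatest (fun l => ∃ z ∈ V, c.coeff l z ≠ 0) c.natDegree,
      Nat.findGreatest_spec (P := fun l => ∃ z ∈ V, c.coeff l z ≠ 0) (hbound l hl) hl,
      fun m hm z hz => ?_⟩
    by_contra hcon
    exact absurd (Nat.le_findGreatest (P := fun l => ∃ z ∈ V, c.coeff l z ≠ 0)
      (hbound m ⟨z, hz, hcon⟩) ⟨z, hz, hcon⟩) (by omega)
  set V₁ : Set (Phase n) := V ∩ c.coeff N ⁻¹' {0}ᶜ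
  have hV₁V : V₁ ⊆ V := Set.inter_subset_left
  have hV₁ : IsOpen V₁ :=
    (((hc N).continuousOn).mono hVU).isOpen_inter_preimage hV isOpen_compl_singleton
  have hV₁ne : V₁.Nonempty := ⟨z₁, hz₁, hz₁'⟩
  set u : V₁ → ℂ := fun z => (c.coeff N z)⁻¹ with hu
  have hKc : ∀ m, (C u * polyKOn c V₁).coeff m
      = fun z : V₁ => (c.coeff N z)⁻¹ * c.coeff m z := by
    intro m
    ext z
    rw [coeff_C_mul, polyKOn, coeff_map]
    rfl
  have hKmonic : (C u * polyKOn c V₁).Monic := by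
    refine monic_of_natDegree_le_of_coeff_eq_one N ?_ ?_
    · rw [natDegree_le_iff_coeff_eq_zero]
      intro m hm
      rw [hKc]
      ext z
      simp [hNmax m hm z (hV₁V z.2)]
    · rw [hKc]
      ext z
      exact inv_mul_cancel₀ z.2.2
  have hP : (C u * polyKOn c V₁ * polyBOn V₁).Monic := hKmonic.mul (monic_polyBOn V₁)
  have htop : ∀ z ∈ V₁, tauCoeff α 0 0 c (N + (2 * n + 1)) z = c.coeff N z := by
    intro z hz
    change (tau α 0 0 c z).coeff _ = _
    have hle : (polyK c z).natDegree ≤ N := by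
      rw [natDegree_le_iff_coeff_eq_zero]
      intro m hm
      rw [polyK_coeff, hNmax m hm z (hV₁V hz)]
    have h1 : (polyB z).coeff (2 * n + 1) = 1 := by
      rw [polyB_eq, coeff_add, coeff_X_pow, if_pos rfl,
        coeff_eq_zero_of_natDegree_lt ((natDegree_oddPoly _).trans_lt (by omega)), add_zero]
    rw [tau_zero_zero, coeff_mul_add_eq_of_natDegree_le hle (natDegree_polyB z), h1, mul_one, polyK_coeff]
  have hdiff : ∀ l, ∀ z ∈ V₁, HasFDerivAt (tauCoeff α 0 0 c l)
      (fderiv ℂ (tauCoeff α 0 0 c l) z) z := fun l z hz =>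
    ((analyticOnNhd_tauCoeff hc l) z (hVU (hV₁V hz))).differentiableAt.hasFDerivAt
  have hmemT : ∀ l z, fderiv ℂ (tauCoeff α 0 0 c l) z ∈ tauSpan α c z := fun l z =>
    Submodule.subset_span ⟨l, rfl⟩
  -- Since B is monic, the top coefficient of τ is c_N. The normalized coefficients are the
  -- quotients τ_l / τ_{N+2n+1}, whose differentials are combinations of the dτ_l.
  have hcoeff : ∀ l, (C u * polyKOn c V₁ * polyBOn V₁).coeff l
      ∈ closedSubring (tauSpan α c) V₁ := by
    intro l
    refine ⟨fun z => (tauCoeff α 0 0 c (N + (2 * n + 1)) z)⁻¹ * tauCoeff α 0 0 c l z,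
      fun z => ?_, fun z hz => ?_⟩
    · rw [mul_assoc, coeff_C_mul, Pi.mul_apply, tauCoeff_eq_coeff (α := α)]
      beta_reduce
      rw [htop z z.2]
    · have hne0 : tauCoeff α 0 0 c (N + (2 * n + 1)) z ≠ 0 := by
        rw [htop z hz]; exact hz.2
      exact ⟨_, add_mem (Submodule.smul_mem _ _ (hmemT l z))
        (Submodule.smul_mem _ _ (Submodule.smul_mem _ _ (hmemT (N + (2 * n + 1)) z))),
        ((hasDerivAt_inv hne0).comp_hasFDerivAt z (hdiff (N + (2 * n + 1)) z hz)).mul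
          (hdiff l z hz)⟩
  obtain ⟨p, hpmap, -, hpmonic⟩ := lifts_and_natDegree_eq_and_monic
    (f := (closedSubring (tauSpan α c) V₁).subtype)
    ((lifts_iff_coeff_lifts _).2 fun l => ⟨⟨_, hcoeff l⟩, rfl⟩) hP
  have hint : ∀ i : Fin n, IsIntegral (closedSubring (tauSpan α c) V₁)
      (fun z : V₁ => z.1 (genB i)) := by
    intro i
    rw [← polyBOn_coeff]
    -- A monic factor of a monic polynomial over a subring has coefficients integral over that
    -- subring.
    refine isIntegral_coeff_of_dvd p (polyBOn V₁) hpmonic (monic_polyBOn V₁) ?_ _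
    have : p.map (algebraMap (closedSubring (tauSpan α c) V₁) (V₁ → ℂ))
        = C u * polyKOn c V₁ * polyBOn V₁ := hpmap
    rw [this]
    exact Dvd.intro_left _ rfl
  obtain ⟨W, hWV, hW, hWne, hWQ⟩ := exists_open_forall
    (fun (i : Fin n) z => (ContinuousLinearMap.proj (genB i) : Phase n →L[ℂ] ℂ) ∈ tauSpan α c z)
    hV₁ hV₁ne fun i W hWV hW hWne =>
      exists_open_fderiv_mem_of_isIntegral (tauSpan α c) hWV hW hWne (fun z => z (genB i))
        (fun _ => ContinuousLinearMap.proj (genB i))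
        (fun z => (ContinuousLinearMap.proj (genB i) : Phase n →L[ℂ] ℂ).hasFDerivAt) (hint i)
  refine ⟨W, hWV.trans hV₁V, hW, hWne, fun z hz x => ?_⟩
  rw [dB, cov]
  refine Submodule.sum_mem _ fun b _ => ?_
  rcases b with b | b | b
  · convert zero_mem (tauSpan α c z)
    ext v
    simp [covB]
  · exact Submodule.smul_mem _ _ (hWQ z hz b)
  · convert zero_mem (tauSpan α c z)
    ext v
    simp [covB]

end offDiagonal

/-! ### Conclusion by continuity and density -/

lemma continuousOn_bracket (α η : ℂ) (k : Fin 2) {U : Set (Phase n)} {f g : Phase n → ℂ}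
    (hf : AnalyticOnNhd ℂ f U) (hg : AnalyticOnNhd ℂ g U) :
    ContinuousOn (bracket α η k f g) U := by
  have hd : ∀ {f : Phase n → ℂ}, AnalyticOnNhd ℂ f U → ∀ a,
      ContinuousOn (partialDeriv a f) U := fun hf a =>
    hf.fderiv.continuousOn.clm_apply continuousOn_const
  exact continuousOn_finsetSum _ fun a _ => continuousOn_finsetSum _ fun b _ =>
    (((continuous_tensor α η k a b).continuousOn).mul (hd hf a)).mul (hd hg b)

lemma bracket_tauCoeff_eq_zero {α : ℂ} (η : ℂ) (k : Fin 2) {U : Set (Phase n)} (hU : IsOpen U)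
    {a d : ℂ[X]} {c : (Phase n → ℂ)[X]} (hc : ∀ l, AnalyticOnNhd ℂ (c.coeff l) U) {e : Fin n → ℕ}
    (he : OnlyIndependentCoeffs α a d c e U) (i j : Fin n) {z : Phase n} (hz : z ∈ U) :
    bracket α η k (tauCoeff α a d c (e i)) (tauCoeff α a d c (e j)) z = 0 := by
  have hn : 1 ≤ n := Nat.one_le_of_lt i.is_lt
  set H : Fin n → Phase n → ℂ := fun i => tauCoeff α a d c (e i) with hH
  by_contra hne
  -- A nonzero value persists on the open set V; it suffices to find one point of V where the
  -- bracket vanishes.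
  set V : Set (Phase n) := U ∩ bracket α η k (H i) (H j) ⁻¹' {0}ᶜ
  have hVU : V ⊆ U := Set.inter_subset_left
  have hV : IsOpen V := (continuousOn_bracket α η k (analyticOnNhd_tauCoeff hc _)
    (analyticOnNhd_tauCoeff hc _)).isOpen_inter_preimage hU isOpen_compl_singleton
  have hmeet : ∀ W ⊆ V, IsOpen W → W.Nonempty →
      ∃ z ∈ W, ∀ l, DependentAt α H (tauCoeff α a d c l) z := by
    rintro W hWV hW ⟨w, hw⟩
    obtain ⟨z, hzW, -, -, hz⟩ := mem_closure_iff.1 (he (hVU (hWV hw))) W hW hw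
    exact ⟨z, hzW, hz⟩
  obtain ⟨W, hWV, hW, hWne, hWgen⟩ := exists_open_generic hn α a d hV ⟨z, hz, hne⟩
  by_cases had : a ≠ 0 ∨ d ≠ 0
  · obtain ⟨w, hw, hdep⟩ := hmeet W hWV hW hWne
    obtain ⟨r, hr, hrad⟩ := hWgen w hw
    exact (hWV hw).2 (bracket_eq_zero_of_diagonal hn η k hc (hVU (hWV hw)) hr (hrad had) H hdep i j)
  · simp only [ne_eq, not_or, not_not] at had
    obtain ⟨rfl, rfl⟩ := had
    -- With zero diagonal, c may still vanish identically on W. Then τ vanishes near each point of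
    -- W, so dH_i = 0 there.
    by_cases hc0 : ∃ l, ∃ z ∈ W, c.coeff l z ≠ 0
    · obtain ⟨W', hW'W, hW', hW'ne, hdB⟩ :=
        exists_open_dB_mem (α := α) hc (hWV.trans hVU) hW hc0
      obtain ⟨w, hw, hdep⟩ := hmeet W' (hW'W.trans hWV) hW' hW'ne
      obtain ⟨r, hr, -⟩ := hWgen w (hW'W hw)
      refine (hWV (hW'W hw)).2 (bracket_eq_zero_of_separated hn η k hr (fun _ => 0) (fun _ => 1) H
        ?_ (fun l => ?_) i j)
      · simpa using linearIndependent_dB hn hr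
      · have hle : tauSpan α c w ≤ integralSpan α H w := by
          rw [tauSpan, Submodule.span_le]
          rintro _ ⟨l, rfl⟩
          exact hdep l
        convert hle (hdB w hw (r l)) using 1
        ext v
        simp
    · push Not at hc0
      obtain ⟨w, hw⟩ := hWne
      refine (hWV hw).2 ?_
      have h0 : fderiv ℂ (H i) w = 0 := by
        have : H i =ᶠ[nhds w] fun _ => 0 := by
          filter_upwards [hW.mem_nhds hw] with y hy
          have hK : polyK c y = 0 := by
            ext l
            rw [polyK_coeff, hc0 l y hy, coeff_zero]
          change (tau α 0 0 c y).coeff _ = 0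
          rw [tau_zero_zero, hK, zero_mul, coeff_zero]
        rw [this.fderiv_eq]
        simp
      rw [bracket_eq, h0]
      simp

end

end ReflectionAlgebra

theorem proposition3 (n : ℕ) (α η : ℂ) (U : Set (ReflectionAlgebra.Phase n)) (hU : IsOpen U)
    (a d : ℂ[X]) (c : (ReflectionAlgebra.Phase n → ℂ)[X])
    (hc : ∀ l : ℕ, AnalyticOnNhd ℂ (c.coeff l) U)
    (e : Fin n → ℕ) (he : ReflectionAlgebra.OnlyIndependentCoeffs α a d c e U) :
    ∀ i j : Fin n, ∀ z ∈ U,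
      ReflectionAlgebra.bracket α η 0 (ReflectionAlgebra.tauCoeff α a d c (e i))
          (ReflectionAlgebra.tauCoeff α a d c (e j)) z = 0 ∧
        ReflectionAlgebra.bracket α η 1 (ReflectionAlgebra.tauCoeff α a d c (e i))
          (ReflectionAlgebra.tauCoeff α a d c (e j)) z = 0 :=
  fun i j _ hz => ⟨ReflectionAlgebra.bracket_tauCoeff_eq_zero η 0 hU hc he i j hz,
    ReflectionAlgebra.bracket_tauCoeff_eq_zero η 1 hU hc he i j hz⟩
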